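/- **Setting.** Let $T_b>0$, $\omega_b=2\pi/T_b$, $\gamma_{\rm in}\in\mathbb R$, and let $V\in C^2(\mathbb R)$ be even. Let ${\bf R}$ be a bounded linear operator on $\ell^2(\mathbb Z;\mathbb R^2)$ whose matrix elements satisfy $$|R_{ml}x|\le C\,|\nu_R|^{|m-l|}\,|x|\qquad (m,l\in\mathbb Z,\ x\in\mathbb R^2),\qquad 0<C<\infty,\quad 0<|\nu_R|<1 .$$ Let $H^0_{T_b}$ and $H^2_{T_b}$ be the spaces of even functions in $L^2(\mathbb R/T_b\mathbb Z;\mathbb R^2)$, respectively $H^2(\mathbb R/T_b\mathbb Z;\mathbb R^2)$, and let $\mathcal H^2_{T_b}$ be the space of sequences $X=\{x_n\}_{n\in\mathbb Z}$ in $H^2_{T_b}$ with $\|X\|^2=\sum_n\|x_n\|^2_{H^2}<\infty$. For $X\in\mathcal H^2_{T_b}$ and $\lambda\in\mathbb R$ put $$[F(X,\lambda)]_n=\begin{pmatrix}\ddot x_n^A+V'(x_n^A)-\gamma_{\rm in}x_n^B\\ \ddot x_n^B+V'(x_n^B)-\gamma_{\rm in}x_n^A\end{pmatrix}+\lambda\sum_{l\in\mathbb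 Z}R_{nl}x_l ,\qquad n\in\mathbb Z .$$ Let $x_*=(x_*^A,x_*^B)\in H^2_{T_b}$ be a solution of the isolated dimer system $\ddot x^A+V'(x^A)-\gamma_{\rm in}x^B=0$, $\ddot x^B+V'(x^B)-\gamma_{\rm in}x^A=0$, and let $X_*\in\mathcal H^2_{T_b}$ be the sequence equal to $x_*$ at $n=0$ and to $0$ at every $n\ne0$. Assume (a) (non-resonance) $(n\omega_b)^2\ne V''(0)\pm\gamma_{\rm in}$ for all $n\in\mathbb Z$; (b) (non-degeneracy) the only $y=(y^A,y^B)\in H^2_{T_b}$ with $\ddot y^A+V''(x_*^A)y^A-\gamma_{\rm in}y^B=0$ and $\ddot y^B+V''(x_*^B)y^B-\gamma_{\rm in}y^A=0$ is $y=0$. A *breather curve* on $[0,\Lambda)$ is a $C^1$ map $[0,\Lambda)\to\mathcal H^2_{T_b}$, $\lambda\mapsto X^\lambda=\{x_n(\cdot,\lambda)\}_{n\in\mathbb Z}$, with $X^0=X_*$ and $F(X^\lambda,\lambda)=0$ for all $\lambda\in[0,\Lambda)$. **Theorem 4.1.** There is $\lambda_b>0$ such that a breather curve on $[0,\lambda_b)$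 exists, and there are constants $C_1>0$, $C_2>0$ and $\mu\in(0,1)$ such that for every $\Lambda\le\lambda_b$ and every breather curve $X^\lambda$ on $[0,\Lambda)$ (in particular for $\Lambda=\lambda_b$) $$\|x_n(\cdot,\lambda)\|_{L^2(0,T_b)}\le C_1\,e^{C_2\lambda}\,\mu^{|n|}\qquad\text{for all } n\in\mathbb Z \text{ and all } \lambda\in[0,\Lambda).$$ -/

import Mathlib

open MeasureTheory Set
open scoped ContDiff ENNReal

namespace DimerArray

noncomputable section

/-- Amplitudes `(x^A, x^B)` of one dimer, with the Euclidean norm; coordinate `0` is the `A` site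
and coordinate `1` is the `B` site. -/
abbrev Cell := EuclideanSpace ℝ (Fin 2)

/-- `ℓ²(ℤ; ℝ²)`. -/
abbrev Lattice := lp (fun _ : ℤ => Cell) 2

/-- `L²(ℝ/Tℤ; ℝ²)`. The measure on `AddCircle T` has total mass `T`, so the norm is that of
`L²(0, T)`. -/
abbrev L2 (T : ℝ) [Fact (0 < T)] := Lp Cell 2 (volume : Measure (AddCircle T))

variable {T : ℝ} [Fact (0 < T)]

/-- `v` is the weak derivative of `u` on the circle `ℝ/Tℤ`: `∫ φ' u = - ∫ φ v` for every smooth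
`T`-periodic test function `φ`. -/
def IsWeakDeriv (u v : L2 T) : Prop :=
  ∀ φ ψ : C(AddCircle T, ℝ), ContDiff ℝ ∞ (fun s : ℝ => φ (s : AddCircle T)) →
    (∀ s : ℝ, HasDerivAt (fun r : ℝ => φ (r : AddCircle T)) (ψ (s : AddCircle T)) s) →
    ∫ t, ψ t • u t = - ∫ t, φ t • v t

/-- `u (-t) = u t` for almost every `t`. -/
def IsEvenLoop (u : L2 T) : Prop := ∀ᵐ t : AddCircle T, u (-t) = u t

theorem integrable_smul (φ : C(AddCircle T, ℝ)) (u : L2 T) :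
    Integrable (fun t => φ t • u t) (volume : Measure (AddCircle T)) := by
  have hu : Integrable (fun t => u t) (volume : Measure (AddCircle T)) :=
    (Lp.memLp u).integrable one_le_two
  have hφ : AEStronglyMeasurable (fun t => φ t) (volume : Measure (AddCircle T)) :=
    φ.continuous.aestronglyMeasurable
  have hb : ∀ᵐ t : AddCircle T, ‖φ t‖ ≤ ‖φ‖ :=
    Filter.Eventually.of_forall fun t => φ.norm_coe_le_norm t
  exact Integrable.bdd_smul (f := fun t => u t) (φ := fun t => φ t) hu ‖φ‖ hφ hb

theorem IsWeakDeriv.zero : IsWeakDeriv (0 : L2 T) 0 := by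
  intro φ ψ _ _
  have h : ∀ f : C(AddCircle T, ℝ), ∫ t, f t • (0 : L2 T) t = 0 := by
    intro f
    refine integral_eq_zero_of_ae ?_
    filter_upwards [Lp.coeFn_zero Cell 2 (volume : Measure (AddCircle T))] with t ht
    rw [ht]; simp
  rw [h, h, neg_zero]

theorem IsWeakDeriv.add {u v u' v' : L2 T} (h : IsWeakDeriv u v) (h' : IsWeakDeriv u' v') :
    IsWeakDeriv (u + u') (v + v') := by
  intro φ ψ hφ hψ
  have key : ∀ (f : C(AddCircle T, ℝ)) (a b : L2 T),
      ∫ t, f t • (a + b) t = (∫ t, f t • a t) + ∫ t, f t • b t := by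
    intro f a b
    rw [← integral_add (integrable_smul f a) (integrable_smul f b)]
    refine integral_congr_ae ?_
    filter_upwards [Lp.coeFn_add a b] with t ht
    rw [ht, Pi.add_apply, smul_add]
  rw [key, key, h φ ψ hφ hψ, h' φ ψ hφ hψ, neg_add]

theorem IsWeakDeriv.smul (c : ℝ) {u v : L2 T} (h : IsWeakDeriv u v) :
    IsWeakDeriv (c • u) (c • v) := by
  intro φ ψ hφ hψ
  have key : ∀ (f : C(AddCircle T, ℝ)) (a : L2 T),
      ∫ t, f t • (c • a) t = c • ∫ t, f t • a t := by
    intro f a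
    rw [← integral_smul]
    refine integral_congr_ae ?_
    filter_upwards [Lp.coeFn_smul c a] with t ht
    simp only [ht, Pi.smul_apply]
    rw [smul_comm]
  rw [key, key, h φ ψ hφ hψ, smul_neg]

theorem ae_neg {p : AddCircle T → Prop} (h : ∀ᵐ t : AddCircle T, p t) :
    ∀ᵐ t : AddCircle T, p (-t) :=
  (Measure.measurePreserving_neg (volume : Measure (AddCircle T))).quasiMeasurePreserving.ae h

variable (T) in
/-- The Sobolev space `H²_T` of even `T`-periodic `ℝ²`-valued functions. An element is the triple
`(u, u', u'')` of a function in `L²` and its first two weak derivatives (which `u` determines), and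
its squared norm is `‖u‖² + ‖u'‖² + ‖u''‖²`, with `L²` norms. -/
def H2 : Submodule ℝ (PiLp 2 (fun _ : Fin 3 => L2 T)) where
  carrier := {u | IsWeakDeriv (u 0) (u 1) ∧ IsWeakDeriv (u 1) (u 2) ∧ IsEvenLoop (u 0)}
  zero_mem' := by
    refine ⟨IsWeakDeriv.zero, IsWeakDeriv.zero, ?_⟩
    have h0 := Lp.coeFn_zero Cell 2 (volume : Measure (AddCircle T))
    change IsEvenLoop (0 : L2 T)
    filter_upwards [h0, ae_neg h0] with t h1 h2
    rw [h1, h2]; rfl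
  add_mem' := by
    rintro u v ⟨h1, h2, h3⟩ ⟨k1, k2, k3⟩
    refine ⟨h1.add k1, h2.add k2, ?_⟩
    change IsEvenLoop (u 0 + v 0)
    have ha := Lp.coeFn_add (u 0) (v 0)
    filter_upwards [ha, ae_neg ha, h3, k3] with t a1 a2 a3 a4
    rw [a1, a2, Pi.add_apply, Pi.add_apply, a3, a4]
  smul_mem' := by
    rintro c u ⟨h1, h2, h3⟩
    refine ⟨h1.smul c, h2.smul c, ?_⟩
    change IsEvenLoop (c • u 0)
    have ha := Lp.coeFn_smul c (u 0)
    filter_upwards [ha, ae_neg ha, h3] with t a1 a2 a3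
    rw [a1, a2, Pi.smul_apply, Pi.smul_apply, a3]

/-- The underlying `L²` function of an element of `H²_T`. -/
def toL2 (u : H2 T) : L2 T := (u : PiLp 2 (fun _ : Fin 3 => L2 T)) 0

/-- The second weak derivative of an element of `H²_T`. -/
def ddot (u : H2 T) : L2 T := (u : PiLp 2 (fun _ : Fin 3 => L2 T)) 2

variable (T) in
/-- The loop space: square-summable sequences, indexed by `ℤ`, of elements of `H²_T`, with norm
`‖X‖² = ∑ₙ ‖xₙ‖²_{H²}`. -/
abbrev LoopSpace := lp (fun _ : ℤ => H2 T) 2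

/-- The matrix element `R_{ml}` of a bounded operator `R` on `ℓ²(ℤ; ℝ²)`. -/
def matrixElement (R : Lattice →L[ℝ] Lattice) (m l : ℤ) : Cell →L[ℝ] Cell :=
  (lp.evalCLM ℝ (fun _ : ℤ => Cell) 2 m).comp
    (R.comp (lp.singleContinuousLinearMap ℝ (fun _ : ℤ => Cell) 2 l))

/-- `(R X)_m = ∑_l R_{ml} x_l`, the sum being taken in `L²(ℝ/Tℤ; ℝ²)`. -/
def coupling (R : Lattice →L[ℝ] Lattice) (X : LoopSpace T) (m : ℤ) : L2 T :=
  ∑' l : ℤ, (matrixElement R m l).compLp (toL2 (X l))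

/-- `(x^A, x^B) ↦ (V'(x^A) - γ x^B, V'(x^B) - γ x^A)`. -/
def cellForce (V : ℝ → ℝ) (γ : ℝ) (x : Cell) : Cell :=
  !₂[deriv V (x 0) - γ * x 1, deriv V (x 1) - γ * x 0]

/-- The isolated dimer system: `ẍ^A + V'(x^A) - γ x^B = 0` and `ẍ^B + V'(x^B) - γ x^A = 0`. -/
def IsDimerOrbit (V : ℝ → ℝ) (γ : ℝ) (x : H2 T) : Prop :=
  ∀ᵐ t, ddot x t + cellForce V γ (toL2 x t) = 0

/-- The operator `L_*`, the linearization of the isolated dimer system about `xs`, as a map from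
`H²_T` to functions of `t`. -/
def linearization (V : ℝ → ℝ) (γ : ℝ) (xs y : H2 T) (t : AddCircle T) : Cell :=
  ddot y t +
    !₂[deriv (deriv V) (toL2 xs t 0) * toL2 y t 0 - γ * toL2 y t 1,
       deriv (deriv V) (toL2 xs t 1) * toL2 y t 1 - γ * toL2 y t 0]

/-- The `n`-th component of `F(X, lam)`. -/
def latticeMap (V : ℝ → ℝ) (γ : ℝ) (R : Lattice →L[ℝ] Lattice) (X : LoopSpace T) (lam : ℝ)
    (n : ℤ) (t : AddCircle T) : Cell :=
  ddot (X n) t + cellForce V γ (toL2 (X n) t) + lam • coupling R X n t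

/-- The anticontinuum state `{…, 0, 0, xs, 0, 0, …}`, with `xs` at site `0`. -/
def anticontinuum (xs : H2 T) : LoopSpace T := lp.single 2 (0 : ℤ) xs

/-- `X` is a `C¹` curve `[0, Λ) → LoopSpace T` that starts at the anticontinuum state and satisfies
`F(X lam, lam) = 0` for all `lam ∈ [0, Λ)`. -/
structure IsBreatherCurve (V : ℝ → ℝ) (γ : ℝ) (R : Lattice →L[ℝ] Lattice) (xs : H2 T)
    (Λ : ℝ) (X : ℝ → LoopSpace T) : Prop where
  contDiffOn : ContDiffOn ℝ 1 X (Ico 0 Λ)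
  initial : X 0 = anticontinuum xs
  solves : ∀ lam ∈ Ico 0 Λ, ∀ n : ℤ, ∀ᵐ t, latticeMap V γ R (X lam) lam n t = 0

end

end DimerArray

open DimerArray

/-!
The equation `F(X, lam) = 0` is a weakly coupled system of identical one-site problems
`f(x_n) + lam * ∑ R_{nl} x_l = 0`, where `f(x) = ẍ + cellForce x` maps the even Sobolev loops `H2`
to the even loops in `L²`.

*One site.* In the Hartley basis `cos ωₙt + sin ωₙt` of `L²` (`isHilbertSum_mode`), a weak
derivative is a flip and a scaling of the coefficients (`isWeakDeriv_iff`), and a loop is even iff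
its coefficients are. Hence `u ↦ ü - u` is an isomorphism from `H2` onto the even loops
(`bijective_ddot_sub`), and the Hartley series of an element of `H2` converges so fast that `H2`
embeds compactly into the continuous loops (`isCompactOperator_sobolev`). Linearizations of `f` are
compact perturbations of `u ↦ ü - u`, so by Fredholm's alternative they are isomorphisms as soon as
they are injective (`exists_equiv_linearization`). At `xs` this is the non-degeneracy assumption; at
`0` it follows from non-resonance, mode by mode (`linearization_zero_injective`).

*The lattice.* The map `f` has a derivative that is uniformly continuous on balls, a property
(`UniformC1`) that is inherited by the map induced on square-summable sequences. The linearization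
of that map at the anticontinuum state is block diagonal, with blocks the isomorphisms above, and
the coupling is a bounded operator by its exponential localization (`exists_lp_matrix`). The
implicit function theorem gives a `C¹` curve of solutions (`UniformC1.exists_curve`).

*Localization.* For small `lam`, a solution in a small ball around the anticontinuum state lies
in the ball of half the radius, so no curve of solutions that starts at the centre can leave it
(`UniformC1.exists_trapped`). In the ball, all components `x_n` with `n ≠ 0` are small; inverting
the linearization at `0` bounds their norms by a small multiple of the convolution of the sequence
of norms with `|ν|^|k|` (`UniformC1.exists_norm_le_convolution`). Such a sequence decays
exponentially (`le_mul_pow_natAbs_of_le_convolution`).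
-/

/-! ### Maps with a derivative that is uniformly continuous on balls -/

section UniformC1

open Filter Metric Topology

variable {E F G : Type*} [NormedAddCommGroup E] [NormedSpace ℝ E]
  [NormedAddCommGroup F] [NormedSpace ℝ F] [NormedAddCommGroup G] [NormedSpace ℝ G]

/-- `f` is differentiable with derivative `f'`, and `f'` is bounded and uniformly continuous on
every ball. In infinite dimensions this is stronger than being `C¹`, and unlike `C¹` it passes to
the maps that `f` induces on continuous functions and on square-summable sequences. -/
structure UniformC1 (f : E → F) (f' : E → E →L[ℝ] F) : Prop where
  hasFDerivAt : ∀ x, HasFDerivAt f (f' x) x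
  bounded : ∀ r : ℝ, ∃ M : ℝ, 0 ≤ M ∧ ∀ x, ‖x‖ ≤ r → ‖f' x‖ ≤ M
  uniform : ∀ r ε : ℝ, 0 < ε → ∃ δ > 0, ∀ x y, ‖x‖ ≤ r → ‖y‖ ≤ r → ‖y - x‖ ≤ δ →
    ‖f' y - f' x‖ ≤ ε

namespace UniformC1

variable {f : E → F} {f' : E → E →L[ℝ] F}

/-- First-order Taylor expansion, with an error that is uniform on balls. -/
theorem taylor (h : UniformC1 f f') (r ε : ℝ) (hε : 0 < ε) :
    ∃ δ > 0, ∀ x y, ‖x‖ ≤ r → ‖y‖ ≤ r → ‖y - x‖ ≤ δ →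
      ‖f y - f x - f' x (y - x)‖ ≤ ε * ‖y - x‖ := by
  obtain ⟨δ, hδ, H⟩ := h.uniform r ε hε
  refine ⟨δ, hδ, fun x y hx hy hxy => ?_⟩
  refine (convex_segment x y).norm_image_sub_le_of_norm_hasFDerivWithin_le'
    (f' := f') (fun z _ => (h.hasFDerivAt z).hasFDerivWithinAt) (fun z hz => ?_)
    (left_mem_segment ℝ x y) (right_mem_segment ℝ x y)
  have hzr : z ∈ closedBall (0 : E) r :=
    (convex_closedBall (0 : E) r).segment_subset (by simpa using hx) (by simpa using hy) hz
  refine H x z hx (by simpa using hzr) (le_trans ?_ hxy)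
  obtain ⟨a, b, ha, hb, hab, rfl⟩ := hz
  have : a • x + b • y - x = b • (y - x) := by
    rw [← eq_sub_iff_add_eq] at hab
    rw [hab]; module
  rw [this, norm_smul, Real.norm_of_nonneg hb]
  exact mul_le_of_le_one_left (norm_nonneg _) (by linarith)

theorem lipschitz (h : UniformC1 f f') (r : ℝ) :
    ∃ M, 0 ≤ M ∧ ∀ x y, ‖x‖ ≤ r → ‖y‖ ≤ r → ‖f y - f x‖ ≤ M * ‖y - x‖ := by
  obtain ⟨M, hM, H⟩ := h.bounded r
  refine ⟨M, hM, fun x y hx hy => ?_⟩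
  exact (convex_closedBall (0 : E) r).norm_image_sub_le_of_norm_hasFDerivWithin_le
    (fun z _ => (h.hasFDerivAt z).hasFDerivWithinAt) (fun z hz => H z (by simpa using hz))
    (by simpa using hx) (by simpa using hy)

theorem continuous_deriv (h : UniformC1 f f') : Continuous f' := by
  rw [Metric.continuous_iff]
  intro x ε hε
  obtain ⟨δ, hδ, H⟩ := h.uniform (‖x‖ + 1) (ε / 2) (half_pos hε)
  refine ⟨min δ 1, lt_min hδ one_pos, fun y hy => ?_⟩
  rw [dist_eq_norm] at hy ⊢
  have h1 := lt_min_iff.1 hy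
  have h2 : ‖y‖ ≤ ‖x‖ + 1 := by
    have := norm_sub_norm_le y x
    linarith
  exact (H x y (by linarith) h2 h1.1.le).trans_lt (half_lt_self hε)

theorem contDiff (h : UniformC1 f f') : ContDiff ℝ 1 f := by
  rw [contDiff_one_iff_fderiv]
  refine ⟨fun x => (h.hasFDerivAt x).differentiableAt, ?_⟩
  convert h.continuous_deriv using 1
  exact funext fun x => (h.hasFDerivAt x).fderiv

theorem continuous (h : UniformC1 f f') : Continuous f :=
  h.contDiff.continuous

theorem clm_comp (h : UniformC1 f f') (L : F →L[ℝ] G) :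
    UniformC1 (fun x => L (f x)) (fun x => L.comp (f' x)) where
  hasFDerivAt x := L.hasFDerivAt.comp x (h.hasFDerivAt x)
  bounded r := by
    obtain ⟨M, hM, H⟩ := h.bounded r
    exact ⟨‖L‖ * M, by positivity, fun x hx =>
      (L.opNorm_comp_le _).trans (by gcongr; exact H x hx)⟩
  uniform r ε hε := by
    obtain ⟨δ, hδ, H⟩ := h.uniform r (ε / (‖L‖ + 1)) (by positivity)
    refine ⟨δ, hδ, fun x y hx hy hxy => ?_⟩
    rw [← ContinuousLinearMap.comp_sub]
    calc ‖L.comp (f' y - f' x)‖ ≤ ‖L‖ * (ε / (‖L‖ + 1)) :=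
          (L.opNorm_comp_le _).trans (by gcongr; exact H x y hx hy hxy)
      _ ≤ (‖L‖ + 1) * (ε / (‖L‖ + 1)) := by gcongr; linarith
      _ = ε := by field_simp

theorem comp_clm (h : UniformC1 f f') (L : G →L[ℝ] E) :
    UniformC1 (fun x => f (L x)) (fun x => (f' (L x)).comp L) where
  hasFDerivAt x := (h.hasFDerivAt (L x)).comp x L.hasFDerivAt
  bounded r := by
    obtain ⟨M, hM, H⟩ := h.bounded (‖L‖ * r)
    exact ⟨M * ‖L‖, by positivity, fun x hx => (ContinuousLinearMap.opNorm_comp_le _ _).trans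
      (by gcongr; exact H _ ((L.le_opNorm x).trans (by gcongr)))⟩
  uniform r ε hε := by
    obtain ⟨δ, hδ, H⟩ := h.uniform (‖L‖ * r) (ε / (‖L‖ + 1)) (by positivity)
    refine ⟨δ / (‖L‖ + 1), by positivity, fun x y hx hy hxy => ?_⟩
    rw [← ContinuousLinearMap.sub_comp]
    have h1 : ‖L y - L x‖ ≤ δ := by
      rw [← map_sub]
      calc ‖L (y - x)‖ ≤ ‖L‖ * (δ / (‖L‖ + 1)) := (L.le_opNorm _).trans (by gcongr)
        _ ≤ (‖L‖ + 1) * (δ / (‖L‖ + 1)) := by gcongr; linarith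
        _ = δ := by field_simp
    calc ‖(f' (L y) - f' (L x)).comp L‖ ≤ (ε / (‖L‖ + 1)) * ‖L‖ :=
          (ContinuousLinearMap.opNorm_comp_le _ _).trans (by
            gcongr
            exact H _ _ ((L.le_opNorm x).trans (by gcongr)) ((L.le_opNorm y).trans (by gcongr)) h1)
      _ ≤ (ε / (‖L‖ + 1)) * (‖L‖ + 1) := by gcongr; linarith
      _ = ε := by field_simp

theorem clm_add (h : UniformC1 f f') (L : E →L[ℝ] F) :
    UniformC1 (fun x => L x + f x) (fun x => L + f' x) where
  hasFDerivAt x := L.hasFDerivAt.add (h.hasFDerivAt x)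
  bounded r := by
    obtain ⟨M, hM, H⟩ := h.bounded r
    exact ⟨‖L‖ + M, by positivity, fun x hx => (norm_add_le _ _).trans (by gcongr; exact H x hx)⟩
  uniform r ε hε := by
    obtain ⟨δ, hδ, H⟩ := h.uniform r ε hε
    refine ⟨δ, hδ, fun x y hx hy hxy => ?_⟩
    rw [add_sub_add_left_eq_sub]
    exact H x y hx hy hxy

/-- In finite dimensions, balls are compact and every `C¹` map qualifies. -/
theorem of_continuous [ProperSpace E] (hf : ∀ x, HasFDerivAt f (f' x) x) (hf' : Continuous f') :
    UniformC1 f f' where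
  hasFDerivAt := hf
  bounded r := by
    obtain ⟨M, hM⟩ := (isCompact_closedBall (0 : E) r).exists_bound_of_continuousOn
      hf'.continuousOn
    exact ⟨max M 0, le_max_right _ _, fun x hx =>
      (hM x (by simpa using hx)).trans (le_max_left _ _)⟩
  uniform r ε hε := by
    have := (isCompact_closedBall (0 : E) r).uniformContinuousOn_of_continuous hf'.continuousOn
    rw [Metric.uniformContinuousOn_iff_le] at this
    obtain ⟨δ, hδ, H⟩ := this ε hε
    refine ⟨δ, hδ, fun x y hx hy hxy => ?_⟩
    rw [← dist_eq_norm]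
    exact H y (by simpa using hy) x (by simpa using hx) (by rwa [dist_eq_norm])

theorem hasFDerivAt_of_taylor {g : E → F} {x : E} {L : E →L[ℝ] F}
    (h : ∀ ε > 0, ∃ δ > 0, ∀ y, ‖y - x‖ ≤ δ → ‖g y - g x - L (y - x)‖ ≤ ε * ‖y - x‖) :
    HasFDerivAt g L x := by
  rw [hasFDerivAt_iff_isLittleO, Asymptotics.isLittleO_iff]
  intro ε hε
  obtain ⟨δ, hδ, H⟩ := h ε hε
  filter_upwards [closedBall_mem_nhds x hδ] with y hy
  exact H y (by rwa [← dist_eq_norm])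

end UniformC1

end UniformC1

/-! ### Superposition operators on continuous functions -/

section ContinuousFunctions

variable {K E F : Type*} [TopologicalSpace K] [CompactSpace K]
  [NormedAddCommGroup E] [NormedSpace ℝ E] [NormedAddCommGroup F] [NormedSpace ℝ F]

/-- The operator `h ↦ (t ↦ B t (h t))` on continuous functions. -/
noncomputable def ContinuousMap.fiberwise (B : C(K, E →L[ℝ] F)) : C(K, E) →L[ℝ] C(K, F) :=
  LinearMap.mkContinuous
    { toFun := fun h => ⟨fun t => B t (h t), by fun_prop⟩
      map_add' := fun h k => by ext t; simp
      map_smul' := fun c h => by ext t; simp }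
    ‖B‖ (fun h => (ContinuousMap.norm_le _ (by positivity)).2 fun t =>
      ((B t).le_opNorm _).trans (by gcongr; exacts [B.norm_coe_le_norm t, h.norm_coe_le_norm t]))

@[simp] theorem ContinuousMap.fiberwise_apply (B : C(K, E →L[ℝ] F)) (h : C(K, E)) (t : K) :
    ContinuousMap.fiberwise B h t = B t (h t) := rfl

theorem ContinuousMap.norm_fiberwise_le {B : C(K, E →L[ℝ] F)} {M : ℝ} (hM : 0 ≤ M)
    (h : ∀ t, ‖B t‖ ≤ M) : ‖ContinuousMap.fiberwise B‖ ≤ M :=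
  ContinuousLinearMap.opNorm_le_bound _ hM fun x => (ContinuousMap.norm_le _ (by positivity)).2
    fun t => ((B t).le_opNorm _).trans (by gcongr; exacts [h t, x.norm_coe_le_norm t])

theorem ContinuousMap.fiberwise_sub (B B' : C(K, E →L[ℝ] F)) :
    ContinuousMap.fiberwise B - ContinuousMap.fiberwise B' = ContinuousMap.fiberwise (B - B') := by
  ext; simp

/-- The superposition operator `x ↦ f ∘ x` on continuous functions inherits `UniformC1`. -/
theorem UniformC1.continuousMap {f : E → F} {f' : E → E →L[ℝ] F} (h : UniformC1 f f') :
    UniformC1 (fun x : C(K, E) => ContinuousMap.comp ⟨f, h.continuous⟩ x)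
      (fun x => ContinuousMap.fiberwise (ContinuousMap.comp ⟨f', h.continuous_deriv⟩ x)) where
  hasFDerivAt x := by
    refine UniformC1.hasFDerivAt_of_taylor fun ε hε => ?_
    obtain ⟨δ, hδ, H⟩ := h.taylor (‖x‖ + 1) ε hε
    refine ⟨min δ 1, lt_min hδ one_pos, fun y hy => ?_⟩
    rw [le_min_iff] at hy
    refine (ContinuousMap.norm_le _ (by positivity)).2 fun t => ?_
    have h1 : ‖y t - x t‖ ≤ ‖y - x‖ := (y - x).norm_coe_le_norm t
    have hx := x.norm_coe_le_norm t
    have h2 : ‖y t‖ ≤ ‖x‖ + 1 := by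
      have := norm_sub_norm_le (y t) (x t)
      linarith
    refine (H (x t) (y t) (by linarith) h2 (h1.trans hy.1)).trans ?_
    gcongr
  bounded r := by
    obtain ⟨M, hM, H⟩ := h.bounded r
    exact ⟨M, hM, fun x hx => ContinuousMap.norm_fiberwise_le hM fun t =>
      H _ ((x.norm_coe_le_norm t).trans hx)⟩
  uniform r ε hε := by
    obtain ⟨δ, hδ, H⟩ := h.uniform r ε hε
    refine ⟨δ, hδ, fun x y hx hy hxy => ?_⟩
    rw [ContinuousMap.fiberwise_sub]
    exact ContinuousMap.norm_fiberwise_le hε.le fun t =>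
      H _ _ ((x.norm_coe_le_norm t).trans hx) ((y.norm_coe_le_norm t).trans hy)
        (((y - x).norm_coe_le_norm t).trans hxy)

end ContinuousFunctions

/-! ### Operators on square-summable sequences -/

section Sequences

variable {E F : Type*} [NormedAddCommGroup E] [NormedAddCommGroup F]

theorem memlp_of_norm_le {a : ℤ → F} {X : lp (fun _ : ℤ => E) 2} {M : ℝ}
    (σ : ℤ ≃ ℤ) (h : ∀ n, ‖a n‖ ≤ M * ‖X (σ n)‖) : Memℓp a 2 := by
  have hs := (lp.memℓp X).summable (by norm_num)
  refine memℓp_gen ((((σ.summable_iff).2 hs).mul_left (M ^ 2)).of_nonneg_of_le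
    (fun n => by positivity) fun n => ?_)
  have := pow_le_pow_left₀ (norm_nonneg _) (h n) 2
  simpa [mul_pow] using this

theorem lp_norm_le_of_norm_le {Y : lp (fun _ : ℤ => F) 2} {X : lp (fun _ : ℤ => E) 2} {M : ℝ}
    (hM : 0 ≤ M) (σ : ℤ ≃ ℤ) (h : ∀ n, ‖Y n‖ ≤ M * ‖X (σ n)‖) : ‖Y‖ ≤ M * ‖X‖ := by
  have h2 : 0 < (2 : ℝ≥0∞).toReal := by norm_num
  have hX := ((σ.hasSum_iff).2 (lp.hasSum_norm h2 X)).mul_left (M ^ 2)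
  have hle := hasSum_le (fun n => ?_) (lp.hasSum_norm h2 Y) hX
  · have h3 : ‖Y‖ ^ 2 ≤ (M * ‖X‖) ^ 2 := by simpa [mul_pow] using hle
    exact (sq_le_sq₀ (norm_nonneg _) (by positivity)).1 h3
  · have := pow_le_pow_left₀ (norm_nonneg _) (h n) 2
    simpa [mul_pow] using this

variable [NormedSpace ℝ E] [NormedSpace ℝ F]

/-- The operator `(X_n) ↦ (B_n X_{σ n})` on square-summable sequences, for a bounded family of
operators `B_n` and a permutation `σ` of `ℤ`. -/
noncomputable def lpWeighted (σ : ℤ ≃ ℤ) (B : ℤ → E →L[ℝ] F) (hB : ∃ M, 0 ≤ M ∧ ∀ n, ‖B n‖ ≤ M) :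
    lp (fun _ : ℤ => E) 2 →L[ℝ] lp (fun _ : ℤ => F) 2 :=
  LinearMap.mkContinuousOfExistsBound
    { toFun := fun X => ⟨fun n => B n (X (σ n)), by
        obtain ⟨M, _, hM⟩ := hB
        exact memlp_of_norm_le σ fun n => (B n).le_of_opNorm_le (hM n) _⟩
      map_add' := fun X Y => by ext n : 2; exact map_add (B n) _ _
      map_smul' := fun c X => by ext n : 2; exact map_smul (B n) _ _ } (by
    obtain ⟨M, hM0, hM⟩ := hB
    exact ⟨M, fun X => lp_norm_le_of_norm_le hM0 σ fun n => (B n).le_of_opNorm_le (hM n) _⟩)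

@[simp] theorem lpWeighted_apply (σ : ℤ ≃ ℤ) (B : ℤ → E →L[ℝ] F) (hB)
    (X : lp (fun _ : ℤ => E) 2) (n : ℤ) : lpWeighted σ B hB X n = B n (X (σ n)) := rfl

theorem norm_lpWeighted_le (σ : ℤ ≃ ℤ) {B : ℤ → E →L[ℝ] F} (hB) {M : ℝ} (hM0 : 0 ≤ M)
    (hM : ∀ n, ‖B n‖ ≤ M) : ‖lpWeighted σ B hB‖ ≤ M :=
  ContinuousLinearMap.opNorm_le_bound _ hM0 fun _ =>
    lp_norm_le_of_norm_le hM0 σ fun n => (B n).le_of_opNorm_le (hM n) _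

namespace UniformC1

variable {f : E → F} {f' : E → E →L[ℝ] F}

/-- The map induced on square-summable sequences by a map that fixes the origin. -/
noncomputable def lpMap (h : UniformC1 f f') (h0 : f 0 = 0) (X : lp (fun _ : ℤ => E) 2) :
    lp (fun _ : ℤ => F) 2 :=
  ⟨fun n => f (X n), by
    obtain ⟨M, _, H⟩ := h.lipschitz ‖X‖
    refine memlp_of_norm_le (X := X) (M := M) (Equiv.refl ℤ) fun n => ?_
    simpa [h0] using! H 0 (X n) (by simp) (lp.norm_apply_le_norm two_ne_zero X n)⟩

@[simp] theorem lpMap_apply (h : UniformC1 f f') (h0 : f 0 = 0) (X : lp (fun _ : ℤ => E) 2)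
    (n : ℤ) : h.lpMap h0 X n = f (X n) := rfl

theorem exists_bound_deriv (h : UniformC1 f f') (X : lp (fun _ : ℤ => E) 2) :
    ∃ M, 0 ≤ M ∧ ∀ n, ‖f' (X n)‖ ≤ M := by
  obtain ⟨M, hM, H⟩ := h.bounded ‖X‖
  exact ⟨M, hM, fun n => H _ (lp.norm_apply_le_norm two_ne_zero X n)⟩

/-- The map induced on square-summable sequences inherits `UniformC1`: the components of a sequence
of bounded norm all lie in one ball, where the estimates are uniform, and square-sum. -/
theorem lpMap_uniformC1 (h : UniformC1 f f') (h0 : f 0 = 0) :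
    UniformC1 (h.lpMap h0)
      (fun X => lpWeighted (Equiv.refl ℤ) (fun n => f' (X n)) (h.exists_bound_deriv X)) where
  hasFDerivAt X := by
    refine UniformC1.hasFDerivAt_of_taylor fun ε hε => ?_
    obtain ⟨δ, hδ, H⟩ := h.taylor (‖X‖ + 1) ε hε
    refine ⟨min δ 1, lt_min hδ one_pos, fun Y hY => ?_⟩
    rw [le_min_iff] at hY
    refine lp_norm_le_of_norm_le hε.le (Equiv.refl ℤ) fun n => ?_
    have h1 : ‖Y n - X n‖ ≤ ‖Y - X‖ := lp.norm_apply_le_norm two_ne_zero (Y - X) n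
    have hX := lp.norm_apply_le_norm two_ne_zero X n
    have h2 : ‖Y n‖ ≤ ‖X‖ + 1 := by
      have := norm_sub_norm_le (Y n) (X n)
      linarith
    exact H (X n) (Y n) (by linarith) h2 (h1.trans hY.1)
  bounded r := by
    obtain ⟨M, hM, H⟩ := h.bounded r
    exact ⟨M, hM, fun X hX => norm_lpWeighted_le _ _ hM fun n =>
      H _ ((lp.norm_apply_le_norm two_ne_zero X n).trans hX)⟩
  uniform r ε hε := by
    obtain ⟨δ, hδ, H⟩ := h.uniform r ε hε
    refine ⟨δ, hδ, fun X Y hX hY hXY => ?_⟩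
    refine ContinuousLinearMap.opNorm_le_bound _ hε.le fun Z =>
      lp_norm_le_of_norm_le hε.le (Equiv.refl ℤ) fun n => ?_
    refine (f' (Y n) - f' (X n)).le_of_opNorm_le (H (X n) (Y n) ?_ ?_ ?_) (Z n)
    · exact (lp.norm_apply_le_norm two_ne_zero X n).trans hX
    · exact (lp.norm_apply_le_norm two_ne_zero Y n).trans hY
    · exact (lp.norm_apply_le_norm two_ne_zero (Y - X) n).trans hXY

end UniformC1

/-- A family of isomorphisms, uniformly bounded together with their inverses, acts on
square-summable sequences by an isomorphism. -/
noncomputable def lpEquiv (B : ℤ → E ≃L[ℝ] F) (hB : ∃ M, 0 ≤ M ∧ ∀ n, ‖(B n : E →L[ℝ] F)‖ ≤ M)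
    (hB' : ∃ M, 0 ≤ M ∧ ∀ n, ‖((B n).symm : F →L[ℝ] E)‖ ≤ M) :
    lp (fun _ : ℤ => E) 2 ≃L[ℝ] lp (fun _ : ℤ => F) 2 :=
  ContinuousLinearEquiv.equivOfInverse
    (lpWeighted (Equiv.refl ℤ) (fun n => (B n : E →L[ℝ] F)) hB)
    (lpWeighted (Equiv.refl ℤ) (fun n => ((B n).symm : F →L[ℝ] E)) hB')
    (fun X => by ext n : 2; simp) (fun X => by ext n : 2; simp)

theorem summable_pow_natAbs {ν : ℝ} (hν0 : 0 ≤ ν) (hν1 : ν < 1) :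
    Summable fun k : ℤ => ν ^ k.natAbs := by
  refine Summable.of_nat_of_neg ?_ ?_ <;> simpa using summable_geometric_of_lt_one hν0 hν1

theorem summable_pow_natAbs_sub {ν : ℝ} (hν0 : 0 ≤ ν) (hν1 : ν < 1) (n : ℤ) :
    Summable fun l : ℤ => ν ^ (n - l).natAbs :=
  ((Equiv.subLeft n).summable_iff (f := fun k : ℤ => ν ^ k.natAbs)).2
    (summable_pow_natAbs hν0 hν1)

/-- An exponentially localized matrix of operators acts boundedly on square-summable sequences: it
is the sum over `k` of its `k`-th diagonals, whose norms decay geometrically. -/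
theorem exists_lp_matrix [CompleteSpace F] (R : ℤ → ℤ → E →L[ℝ] F) {C ν : ℝ} (hC : 0 ≤ C)
    (hν0 : 0 ≤ ν) (hν1 : ν < 1) (hR : ∀ m l, ‖R m l‖ ≤ C * ν ^ (m - l).natAbs) :
    ∃ S : lp (fun _ : ℤ => E) 2 →L[ℝ] lp (fun _ : ℤ => F) 2,
      ∀ X n, HasSum (fun l => R n l (X l)) (S X n) := by
  have hb : ∀ k n : ℤ, ‖R n (n - k)‖ ≤ C * ν ^ k.natAbs := fun k n => by
    simpa using hR n (n - k)
  let D : ℤ → lp (fun _ : ℤ => E) 2 →L[ℝ] lp (fun _ : ℤ => F) 2 := fun k =>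
    lpWeighted (Equiv.subRight k) (fun n => R n (n - k))
      ⟨C * ν ^ k.natAbs, by positivity, hb k⟩
  have hgeo : Summable fun k : ℤ => C * ν ^ k.natAbs :=
    (summable_pow_natAbs hν0 hν1).mul_left C
  have hD : Summable D := by
    refine Summable.of_norm_bounded hgeo fun k => norm_lpWeighted_le _ _ (by positivity) (hb k)
  refine ⟨∑' k, D k, fun X n => ?_⟩
  have h1 := hD.hasSum.mapL (ContinuousLinearMap.apply ℝ _ X)
  have h2 := h1.mapL (lp.evalCLM ℝ (fun _ : ℤ => F) 2 n)
  rw [← (Equiv.subLeft n).hasSum_iff]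
  exact h2

end Sequences

/-! ### Exponential decay from a convolution inequality -/

section Decay

/-- A bounded sequence that, away from the origin, is dominated by a small multiple of its
convolution with `ν ^ |k|` decays like `μ ^ |n|`, for any `μ ∈ (ν, 1)` for which the multiple is
small enough. -/
theorem le_mul_pow_natAbs_of_le_convolution {a : ℤ → ℝ} {M q ν μ : ℝ} (ha : ∀ n, 0 ≤ a n)
    (haM : ∀ n, a n ≤ M) (hq : 0 ≤ q) (hν : 0 ≤ ν) (hνμ : ν < μ) (hμ : μ < 1)
    (hqS : q * ∑' k : ℤ, (ν / μ) ^ k.natAbs ≤ 1 / 2)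
    (hconv : ∀ n, n ≠ 0 → a n ≤ q * ∑' l : ℤ, ν ^ (n - l).natAbs * a l) (n : ℤ) :
    a n ≤ M * μ ^ n.natAbs := by
  have hμ0 : 0 < μ := hν.trans_lt hνμ
  have hM : 0 ≤ M := (ha 0).trans (haM 0)
  have hr0 : 0 ≤ ν / μ := by positivity
  have hr1 : ν / μ < 1 := (div_lt_one hμ0).2 hνμ
  -- The weight is truncated at `N`, so that the weighted sequence is bounded a priori.
  have key : ∀ (N : ℕ) (n : ℤ), a n ≤ M * μ ^ min n.natAbs N := by
    intro N
    let g : ℤ → ℝ := fun n => a n / μ ^ min n.natAbs N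
    have hg0 : ∀ n, 0 ≤ g n := fun n => div_nonneg (ha n) (by positivity)
    have hbdd : BddAbove (range g) := by
      refine ⟨M / μ ^ N, ?_⟩
      rintro _ ⟨n, rfl⟩
      exact div_le_div₀ hM (haM n) (by positivity)
        (pow_le_pow_of_le_one hμ0.le hμ.le (min_le_right _ _))
    set A := ⨆ n, g n with hA
    have hgA : ∀ n, g n ≤ A := le_ciSup hbdd
    have hA0 : 0 ≤ A := (hg0 0).trans (hgA 0)
    have haA : ∀ n, a n ≤ A * μ ^ min n.natAbs N := fun n => (div_le_iff₀ (by positivity)).1 (hgA n)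
    -- Away from the origin, the convolution inequality halves the bound on the weighted sequence.
    have hstep : ∀ n, g n ≤ max M (A / 2) := by
      intro n
      by_cases hn : n = 0
      · subst hn
        exact le_max_of_le_left (by simpa [g] using haM 0)
      refine le_max_of_le_right ((div_le_iff₀ (by positivity)).2 ((hconv n hn).trans ?_))
      have hterm : ∀ l : ℤ, ν ^ (n - l).natAbs * a l
          ≤ (ν / μ) ^ (n - l).natAbs * (A * μ ^ min n.natAbs N) := by
        intro l
        have h1 : μ ^ ((n - l).natAbs + min l.natAbs N) ≤ μ ^ min n.natAbs N :=
          pow_le_pow_of_le_one hμ0.le hμ.le (by omega)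
        calc ν ^ (n - l).natAbs * a l ≤ ν ^ (n - l).natAbs * (A * μ ^ min l.natAbs N) := by
              gcongr; exact haA l
          _ = (ν / μ) ^ (n - l).natAbs * (A * μ ^ ((n - l).natAbs + min l.natAbs N)) := by
              rw [div_pow, pow_add]; field_simp
          _ ≤ _ := by gcongr
      have hS : HasSum (fun l : ℤ => (ν / μ) ^ (n - l).natAbs) (∑' k : ℤ, (ν / μ) ^ k.natAbs) :=
        ((Equiv.subLeft n).hasSum_iff (f := fun k : ℤ => (ν / μ) ^ k.natAbs)).2
          (summable_pow_natAbs hr0 hr1).hasSum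
      have hS' := hS.mul_right (A * μ ^ min n.natAbs N)
      have hsum : Summable fun l : ℤ => ν ^ (n - l).natAbs * a l :=
        hS'.summable.of_nonneg_of_le (fun l => mul_nonneg (by positivity) (ha l)) hterm
      calc q * ∑' l : ℤ, ν ^ (n - l).natAbs * a l
          ≤ q * ((∑' k : ℤ, (ν / μ) ^ k.natAbs) * (A * μ ^ min n.natAbs N)) := by
            gcongr
            exact hasSum_le hterm hsum.hasSum hS'
        _ = (q * ∑' k : ℤ, (ν / μ) ^ k.natAbs) * (A * μ ^ min n.natAbs N) := by ring
        _ ≤ 1 / 2 * (A * μ ^ min n.natAbs N) := by gcongr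
        _ = A / 2 * μ ^ min n.natAbs N := by ring
    have hAM : A ≤ M := by
      rcases le_max_iff.1 (ciSup_le hstep : A ≤ max M (A / 2)) with h | h
      · exact h
      · linarith
    exact fun n => (haA n).trans (by gcongr)
  simpa using key n.natAbs n

end Decay

/-! ### Continuation of nondegenerate zeros -/

section Continuation

open Metric

variable {E F : Type*} [NormedAddCommGroup E] [NormedSpace ℝ E]
  [NormedAddCommGroup F] [NormedSpace ℝ F]

/-- The implicit function theorem for a perturbation that is linear in the parameter. -/
theorem UniformC1.exists_curve [CompleteSpace E] [CompleteSpace F] {f : E → F}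
    {f' : E → E →L[ℝ] F} (hf : UniformC1 f f') {x₀ : E} (hx₀ : f x₀ = 0) (L : E ≃L[ℝ] F)
    (hL : (L : E →L[ℝ] F) = f' x₀) (S : E →L[ℝ] F) :
    ∃ ε > 0, ∃ X : ℝ → E, ContDiffOn ℝ 1 X (Ico 0 ε) ∧ X 0 = x₀ ∧
      ∀ lam ∈ Ico 0 ε, f (X lam) + lam • S (X lam) = 0 := by
  let Φ : ℝ × E → F := fun p => f p.2 + p.1 • S p.2
  have hΦ : ContDiff ℝ 1 Φ :=
    (hf.contDiff.comp contDiff_snd).add (contDiff_fst.smul (S.contDiff.comp contDiff_snd))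
  have hΦ₀ : ContDiffAt ℝ 1 Φ (0, x₀) := hΦ.contDiffAt
  have hpart : fderiv ℝ Φ (0, x₀) ∘L .inr ℝ ℝ E = L := by
    have h1 : HasFDerivAt (fun x => Φ (0, x)) (fderiv ℝ Φ (0, x₀) ∘L .inr ℝ ℝ E) x₀ :=
      HasFDerivAt.comp x₀ (hΦ₀.differentiableAt one_ne_zero).hasFDerivAt
        (hasFDerivAt_prodMk_right 0 x₀)
    have h2 : HasFDerivAt (fun x => Φ (0, x)) (f' x₀) x₀ := by
      simpa [Φ] using hf.hasFDerivAt x₀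
    rw [hL]
    exact h1.unique h2
  have hinv : (fderiv ℝ Φ (0, x₀) ∘L .inr ℝ ℝ E).IsInvertible := ⟨L, hpart.symm⟩
  let X := hΦ₀.implicitFunction one_ne_zero hinv
  have hX : ContDiffAt ℝ 1 X 0 := hΦ₀.contDiffAt_implicitFunction one_ne_zero hinv
  have hev := (hX.eventually (by simp)).and
    (hΦ₀.eventually_apply_implicitFunction one_ne_zero hinv)
  obtain ⟨ε, hε, H⟩ := Metric.eventually_nhds_iff.1 hev
  have hmem : ∀ lam ∈ Ico (0 : ℝ) ε, dist lam 0 < ε := fun lam h => by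
    simpa [Real.dist_eq, abs_of_nonneg h.1] using h.2
  refine ⟨ε, hε, X, fun lam h => (H (hmem lam h)).1.contDiffWithinAt,
    hΦ₀.implicitFunction_apply_self one_ne_zero hinv, fun lam h => ?_⟩
  have := (H (hmem lam h)).2
  simpa [Φ, hx₀] using this

/-- Zeros of `f + λ S` near a nondegenerate zero `x₀` of `f` are trapped: a curve of them that
starts at `x₀` does not leave a given ball around `x₀` as long as `λ` stays below a bound that does
not depend on the curve. -/
theorem UniformC1.exists_trapped {f : E → F} {f' : E → E →L[ℝ] F} (hf : UniformC1 f f') {x₀ : E}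
    (hx₀ : f x₀ = 0) (L : E ≃L[ℝ] F) (hL : (L : E →L[ℝ] F) = f' x₀) (S : E →L[ℝ] F) {η : ℝ}
    (hη : 0 < η) :
    ∃ lam₁ > 0, ∀ (Λ : ℝ) (X : ℝ → E), Λ ≤ lam₁ → ContinuousOn X (Ico 0 Λ) → X 0 = x₀ →
      (∀ lam ∈ Ico 0 Λ, f (X lam) + lam • S (X lam) = 0) →
      ∀ lam ∈ Ico 0 Λ, ‖X lam - x₀‖ ≤ η := by
  set K : ℝ := ‖(L.symm : F →L[ℝ] E)‖ + 1 with hK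
  have hK0 : 0 < K := by positivity
  obtain ⟨δ, hδ, hT⟩ := hf.taylor (‖x₀‖ + 1) (1 / (4 * K)) (by positivity)
  set ρ : ℝ := min η (min δ 1) with hρ
  have hρ0 : 0 < ρ := by positivity
  have hρη : ρ ≤ η := min_le_left _ _
  have hρδ : ρ ≤ δ := (min_le_right _ _).trans (min_le_left _ _)
  have hρ1 : ρ ≤ 1 := (min_le_right _ _).trans (min_le_right _ _)
  set c : ℝ := ‖S‖ * (‖x₀‖ + 1) + 1 with hc
  have hc0 : 0 < c := by positivity
  refine ⟨ρ / (4 * K * c), by positivity, fun Λ X hΛ hX hX0 hsol => ?_⟩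
  -- No point of the curve has distance between `ρ / 2` and `ρ` from `x₀`.
  have hgap : ∀ lam ∈ Ico 0 Λ, ‖X lam - x₀‖ ≤ ρ → ‖X lam - x₀‖ ≤ ρ / 2 := by
    intro lam hlam hle
    set x := X lam with hx
    have hxr : ‖x‖ ≤ ‖x₀‖ + 1 := by
      have := norm_sub_norm_le x x₀
      linarith
    have h1 := hT x₀ x (by linarith) hxr (hle.trans hρδ)
    have h2 : lam * ‖S x‖ ≤ ρ / (4 * K) := by
      calc lam * ‖S x‖ ≤ ρ / (4 * K * c) * c := by
            have : ‖S x‖ ≤ c := (S.le_opNorm x).trans (by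
              rw [hc]; nlinarith [norm_nonneg S, norm_nonneg x])
            gcongr
            exact hlam.2.le.trans hΛ
        _ = ρ / (4 * K) := by field_simp
    have h3 : L (x - x₀) = -(f x - f x₀ - f' x₀ (x - x₀)) - lam • S x := by
      have h4 : L (x - x₀) = f' x₀ (x - x₀) := by rw [← hL]; rfl
      rw [h4, hx₀, eq_neg_of_add_eq_zero_left (hsol lam hlam)]
      abel
    have h5 : ‖L (x - x₀)‖ ≤ 1 / (4 * K) * ρ + ρ / (4 * K) := by
      rw [h3]
      refine (norm_sub_le _ _).trans (add_le_add ?_ ?_)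
      · rw [norm_neg]
        exact h1.trans (by gcongr)
      · rwa [norm_smul, Real.norm_of_nonneg hlam.1]
    calc ‖x - x₀‖ = ‖L.symm (L (x - x₀))‖ := by simp
      _ ≤ K * ‖L (x - x₀)‖ := by
        refine ((L.symm : F →L[ℝ] E).le_opNorm _).trans ?_
        gcongr
        linarith
      _ ≤ K * (1 / (4 * K) * ρ + ρ / (4 * K)) := by gcongr
      _ = ρ / 2 := by field_simp; ring
  intro lam hlam
  refine le_trans ?_ hρη
  by_contra! hcon
  -- Otherwise some earlier point of the curve lies exactly at distance `ρ`.
  have hsub : Icc 0 lam ⊆ Ico 0 Λ := fun t ht => ⟨ht.1, ht.2.trans_lt hlam.2⟩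
  have hcont : ContinuousOn (fun t => ‖X t - x₀‖) (Icc 0 lam) :=
    ((hX.mono hsub).sub continuousOn_const).norm
  obtain ⟨t, ht, hteq⟩ := intermediate_value_Icc hlam.1 hcont
    (show ρ ∈ Icc _ _ from ⟨by simpa [hX0] using hρ0.le, hcon.le⟩)
  have := hgap t (hsub ht) hteq.le
  simp only at hteq
  linarith

end Continuation

/-! ### Localized solutions of weakly coupled lattice systems -/

section LocalizedCurves

variable {E F : Type*} [NormedAddCommGroup E] [NormedSpace ℝ E]
  [NormedAddCommGroup F] [NormedSpace ℝ F]

/-- Away from the origin, a zero of the coupled lattice system with small components there is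
dominated by the convolution of its norms with the off-diagonal decay of the coupling. -/
theorem UniformC1.exists_norm_le_convolution {f : E → F} {f' : E → E →L[ℝ] F}
    (hf : UniformC1 f f') (h0 : f 0 = 0) (L : E ≃L[ℝ] F) (hL : (L : E →L[ℝ] F) = f' 0)
    {R : ℤ → ℤ → E →L[ℝ] F} {C ν : ℝ} (hC : 0 ≤ C) (hν0 : 0 ≤ ν) (hν1 : ν < 1)
    (hR : ∀ m l, ‖R m l‖ ≤ C * ν ^ (m - l).natAbs) :
    ∃ η > 0, ∃ K > 0, ∀ (X : lp (fun _ : ℤ => E) 2) (n : ℤ) (y : F) (lam : ℝ), 0 ≤ lam →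
      ‖X n‖ ≤ η → HasSum (fun l => R n l (X l)) y → f (X n) + lam • y = 0 →
      ‖X n‖ ≤ K * lam * ∑' l : ℤ, ν ^ (n - l).natAbs * ‖X l‖ := by
  set k : ℝ := ‖(L.symm : F →L[ℝ] E)‖ + 1 with hk
  have hk0 : 0 < k := by positivity
  obtain ⟨δ, hδ, hT⟩ := hf.taylor 1 (1 / (2 * k)) (by positivity)
  refine ⟨min δ 1, by positivity, 2 * k * (C + 1), by positivity,
    fun X n y lam hlam hXn hy hsol => ?_⟩
  rw [le_min_iff] at hXn
  have hsum : Summable fun l : ℤ => ν ^ (n - l).natAbs * ‖X l‖ :=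
    ((summable_pow_natAbs_sub hν0 hν1 n).mul_right ‖X‖).of_nonneg_of_le
      (fun l => by positivity) fun l => by
        gcongr; exact lp.norm_apply_le_norm two_ne_zero X l
  set σ := ∑' l : ℤ, ν ^ (n - l).natAbs * ‖X l‖ with hσ
  have hσ0 : 0 ≤ σ := tsum_nonneg fun l => by positivity
  have hyn : ‖y‖ ≤ C * σ := by
    refine hy.norm_le_of_bounded (hsum.hasSum.mul_left C) fun l => ?_
    rw [← mul_assoc]
    exact (R n l).le_of_opNorm_le (hR n l) _
  have h1 : ‖f (X n) - f' 0 (X n)‖ ≤ 1 / (2 * k) * ‖X n‖ := by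
    simpa [h0] using hT 0 (X n) (by simp) hXn.2 (by simpa using hXn.1)
  have h2 : L (X n) = -(f (X n) - f' 0 (X n)) - lam • y := by
    have h4 : L (X n) = f' 0 (X n) := by rw [← hL]; rfl
    rw [h4, eq_neg_of_add_eq_zero_left hsol]
    abel
  have h3 : ‖L (X n)‖ ≤ 1 / (2 * k) * ‖X n‖ + lam * (C * σ) := by
    rw [h2]
    refine (norm_sub_le _ _).trans (add_le_add (by rwa [norm_neg]) ?_)
    rw [norm_smul, Real.norm_of_nonneg hlam]
    gcongr
  have h4 : ‖X n‖ ≤ k * (1 / (2 * k) * ‖X n‖ + lam * (C * σ)) := by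
    calc ‖X n‖ = ‖L.symm (L (X n))‖ := by simp
      _ ≤ k * ‖L (X n)‖ := by
        refine ((L.symm : F →L[ℝ] E).le_opNorm _).trans ?_
        gcongr
        linarith
      _ ≤ _ := by gcongr
  have h5 : k * (1 / (2 * k) * ‖X n‖ + lam * (C * σ)) = ‖X n‖ / 2 + k * lam * C * σ := by
    field_simp
  have h6 : 0 ≤ k * lam * σ := by positivity
  calc ‖X n‖ ≤ 2 * (k * lam * C * σ) := by linarith
    _ ≤ 2 * k * (C + 1) * lam * σ := by linarith

/-- Continuation from the uncoupled limit: if the linearizations of the one-site problem `f = 0` at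
`0` and at `xs` are isomorphisms, the sequence that is `xs` at the origin and `0` elsewhere
continues to a `C¹` curve of solutions of the weakly coupled problem, and every such curve is
exponentially localized, uniformly. -/
theorem UniformC1.exists_localized_curve [CompleteSpace E] [CompleteSpace F] {f : E → F}
    {f' : E → E →L[ℝ] F} (hf : UniformC1 f f') (h0 : f 0 = 0) {xs : E} (hxs : f xs = 0)
    (L₀ Ls : E ≃L[ℝ] F) (hL₀ : (L₀ : E →L[ℝ] F) = f' 0) (hLs : (Ls : E →L[ℝ] F) = f' xs)
    {R : ℤ → ℤ → E →L[ℝ] F} {C ν : ℝ} (hC : 0 ≤ C) (hν0 : 0 ≤ ν) (hν1 : ν < 1)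
    (hR : ∀ m l, ‖R m l‖ ≤ C * ν ^ (m - l).natAbs) :
    ∃ lam_b : ℝ, 0 < lam_b ∧
      (∃ X : ℝ → lp (fun _ : ℤ => E) 2, ContDiffOn ℝ 1 X (Ico 0 lam_b) ∧
        X 0 = lp.single 2 0 xs ∧
        ∀ lam ∈ Ico 0 lam_b, ∀ n, f (X lam n) + lam • ∑' l, R n l (X lam l) = 0) ∧
      ∃ M μ : ℝ, 0 < M ∧ 0 < μ ∧ μ < 1 ∧
        ∀ (Λ : ℝ) (X : ℝ → lp (fun _ : ℤ => E) 2), Λ ≤ lam_b → ContDiffOn ℝ 1 X (Ico 0 Λ) →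
          X 0 = lp.single 2 0 xs →
          (∀ lam ∈ Ico 0 Λ, ∀ n, f (X lam n) + lam • ∑' l, R n l (X lam l) = 0) →
          ∀ lam ∈ Ico 0 Λ, ∀ n : ℤ, ‖X lam n‖ ≤ M * μ ^ n.natAbs := by
  obtain ⟨S, hS⟩ := exists_lp_matrix R hC hν0 hν1 hR
  set X₀ : lp (fun _ : ℤ => E) 2 := lp.single 2 0 xs with hX₀
  have hX₀0 : X₀ 0 = xs := by simp [hX₀]
  have hX₀n : ∀ n, n ≠ 0 → X₀ n = 0 := fun n hn => by simp [hX₀, hn]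
  have hF := hf.lpMap_uniformC1 h0
  have hFX₀ : hf.lpMap h0 X₀ = 0 := by
    ext n : 2
    by_cases hn : n = 0
    · subst hn; simpa [hX₀0] using hxs
    · simpa [hX₀n n hn] using h0
  let B : ℤ → E ≃L[ℝ] F := fun n => if n = 0 then Ls else L₀
  have hB : ∀ n, (B n : E →L[ℝ] F) = f' (X₀ n) := fun n => by
    by_cases hn : n = 0
    · subst hn; simpa [B, hX₀0] using hLs
    · simpa [B, hn, hX₀n n hn] using hL₀
  let L := lpEquiv B
    ⟨max ‖(Ls : E →L[ℝ] F)‖ ‖(L₀ : E →L[ℝ] F)‖, by positivity, fun n => by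
      by_cases hn : n = 0 <;> simp [B, hn]⟩
    ⟨max ‖(Ls.symm : F →L[ℝ] E)‖ ‖(L₀.symm : F →L[ℝ] E)‖, by positivity, fun n => by
      by_cases hn : n = 0 <;> simp [B, hn]⟩
  have hL : (L : lp (fun _ : ℤ => E) 2 →L[ℝ] lp (fun _ : ℤ => F) 2) =
      lpWeighted (Equiv.refl ℤ) (fun n => f' (X₀ n)) (hf.exists_bound_deriv X₀) := by
    ext X n : 3
    change (B n : E →L[ℝ] F) (X n) = f' (X₀ n) (X n)
    rw [hB]
  have hsolve : ∀ (X : lp (fun _ : ℤ => E) 2) (lam : ℝ),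
      hf.lpMap h0 X + lam • S X = 0 ↔ ∀ n, f (X n) + lam • ∑' l, R n l (X l) = 0 := by
    intro X lam
    rw [lp.ext_iff, funext_iff]
    refine forall_congr' fun n => ?_
    rw [(hS X n).tsum_eq]
    rfl
  obtain ⟨η, hη, K, hK, hconv⟩ := hf.exists_norm_le_convolution h0 L₀ hL₀ hC hν0 hν1 hR
  obtain ⟨ε, hε, X, hXC, hX0, hX⟩ := hF.exists_curve hFX₀ L hL S
  obtain ⟨lam₁, hlam₁, htrap⟩ := hF.exists_trapped hFX₀ L hL S hη
  -- Any rate `μ` slower than that of the coupling can be had, at the cost of a smaller `lam_b`.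
  obtain ⟨μ, hνμ, hμ1⟩ := exists_between hν1
  have hμ0 : 0 < μ := hν0.trans_lt hνμ
  set s := ∑' k : ℤ, (ν / μ) ^ k.natAbs with hs
  have hs0 : 0 ≤ s := tsum_nonneg fun k => by positivity
  set lam₂ : ℝ := 1 / (2 * K * (s + 1)) with hlam₂
  have hlam₂0 : 0 < lam₂ := by positivity
  refine ⟨min ε (min lam₁ lam₂), by positivity,
    ⟨X, hXC.mono (Ico_subset_Ico_right (min_le_left _ _)), hX0,
      fun lam hlam => (hsolve _ _).1 (hX lam ⟨hlam.1, hlam.2.trans_le (min_le_left _ _)⟩)⟩,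
    ‖X₀‖ + η, μ, by positivity, hμ0, hμ1, fun Λ Y hΛ hYC hY0 hY lam hlam n => ?_⟩
  simp only [le_min_iff] at hΛ
  have hball := htrap Λ Y hΛ.2.1 hYC.continuousOn hY0
    (fun t ht => (hsolve _ _).2 (hY t ht)) lam hlam
  have hYn : ∀ m, ‖Y lam m‖ ≤ ‖X₀‖ + η := fun m => by
    have h1 := lp.norm_apply_le_norm two_ne_zero (Y lam) m
    have h2 := norm_sub_norm_le (Y lam) X₀
    linarith
  have hYη : ∀ m, m ≠ 0 → ‖Y lam m‖ ≤ η := fun m hm => by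
    have h1 := lp.norm_apply_le_norm two_ne_zero (Y lam - X₀) m
    simp only [lp.coeFn_sub, Pi.sub_apply, hX₀n m hm, sub_zero] at h1
    exact h1.trans hball
  refine le_mul_pow_natAbs_of_le_convolution (a := fun m => ‖Y lam m‖) (q := K * lam)
    (fun _ => norm_nonneg _) hYn (mul_nonneg hK.le hlam.1) hν0 hνμ hμ1 ?_ (fun m hm => ?_) n
  · have h1 : lam ≤ lam₂ := hlam.2.le.trans hΛ.2.2
    calc K * lam * s ≤ K * lam₂ * (s + 1) := by gcongr; linarith
      _ = 1 / 2 := by rw [hlam₂]; field_simp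
  · refine hconv (Y lam) m _ lam hlam.1 (hYη m hm) (hS (Y lam) m) ?_
    rw [← (hS (Y lam) m).tsum_eq]
    exact hY lam hlam m

end LocalizedCurves

namespace DimerArray

noncomputable section

open Filter Metric Topology

variable {T : ℝ}

/-! ### The Hartley basis -/

variable (T) in
/-- The `n`-th angular frequency `2πn/T`. -/
def freq (n : ℤ) : ℝ := n * (2 * Real.pi / T)

theorem freq_neg (n : ℤ) : freq T (-n) = -freq T n := by simp [freq]

/-- Hartley's function `cas (ωₙ t) = cos (ωₙ t) + sin (ωₙ t)`, for `ωₙ = 2πn/T`. -/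
def cas (n : ℤ) : C(AddCircle T, ℝ) :=
  ⟨fun t => (fourier n t).re + (fourier n t).im, by fun_prop⟩

theorem cas_apply (n : ℤ) (t : AddCircle T) : cas n t = (fourier n t).re + (fourier n t).im := rfl

theorem cas_coe (n : ℤ) (s : ℝ) :
    cas n (s : AddCircle T) = Real.cos (freq T n * s) + Real.sin (freq T n * s) := by
  have h : (2 * Real.pi * Complex.I * n * s / T : ℂ) = ((freq T n * s : ℝ) : ℂ) * Complex.I := by
    simp only [freq]; push_cast; ring
  rw [cas_apply, fourier_coe_apply, h, Complex.exp_ofReal_mul_I_re, Complex.exp_ofReal_mul_I_im]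

theorem hasDerivAt_cas (n : ℤ) (s : ℝ) :
    HasDerivAt (fun r : ℝ => cas n (r : AddCircle T))
      ((freq T n • cas (-n) : C(AddCircle T, ℝ)) (s : AddCircle T)) s := by
  simp only [ContinuousMap.smul_apply, cas_coe, freq_neg]
  have h1 : HasDerivAt (fun r : ℝ => freq T n * r) (freq T n) s := by
    simpa using (hasDerivAt_id s).const_mul (freq T n)
  refine (h1.cos.add h1.sin).congr_deriv ?_
  rw [neg_mul (freq T n), Real.cos_neg, Real.sin_neg, smul_eq_mul]
  ring

theorem contDiff_cas (n : ℤ) : ContDiff ℝ ∞ (fun s : ℝ => cas n (s : AddCircle T)) := by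
  simp only [cas_coe]
  fun_prop

theorem cas_neg_apply (n : ℤ) (t : AddCircle T) : cas n (-t) = cas (-n) t := by
  simp only [cas_apply, fourier_apply, smul_neg, neg_smul]

variable (T) in
/-- The function `cas (ωₙ t)`, normalized in `L²`. -/
def hartley (n : ℤ) : C(AddCircle T, ℝ) := (√T)⁻¹ • cas n

theorem hartley_neg_apply (n : ℤ) (t : AddCircle T) : hartley T n (-t) = hartley T (-n) t := by
  simp [hartley, cas_neg_apply]

variable [hT : Fact (0 < T)]

/-- The inclusion of continuous loops into `L²`. -/
def contToL2 : C(AddCircle T, Cell) →L[ℝ] L2 T :=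
  ContinuousMap.toLp 2 (volume : Measure (AddCircle T)) ℝ

theorem coeFn_contToL2 (f : C(AddCircle T, Cell)) : ∀ᵐ t, contToL2 f t = f t :=
  ContinuousMap.coeFn_toLp (𝕜 := ℝ) volume f

/-- `c ↦ (t ↦ φ(t) c)`. -/
def wave (φ : C(AddCircle T, ℝ)) : Cell →L[ℝ] C(AddCircle T, Cell) :=
  LinearMap.mkContinuous
    { toFun := fun c => ⟨fun t => φ t • c, by fun_prop⟩
      map_add' := fun c d => by ext1 t; simp
      map_smul' := fun r c => by ext1 t; exact smul_comm _ _ _ } ‖φ‖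
    fun c => (ContinuousMap.norm_le _ (by positivity)).2 fun t => by
      simpa [norm_smul] using mul_le_mul_of_nonneg_right (φ.norm_coe_le_norm t) (norm_nonneg c)

@[simp] theorem wave_apply (φ : C(AddCircle T, ℝ)) (c : Cell) (t : AddCircle T) :
    wave φ c t = φ t • c := rfl

theorem norm_wave_le (φ : C(AddCircle T, ℝ)) : ‖wave φ‖ ≤ ‖φ‖ :=
  LinearMap.mkContinuous_norm_le _ (norm_nonneg _) _

/-- `u ↦ ∫ φ u`, as a bounded operator on `L²`. -/
def moment (φ : C(AddCircle T, ℝ)) : L2 T →L[ℝ] Cell :=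
  ContinuousLinearMap.adjoint (contToL2.comp (wave φ))

theorem inner_wave (φ : C(AddCircle T, ℝ)) (c : Cell) (u : L2 T) :
    inner ℝ (contToL2 (wave φ c)) u = inner ℝ c (moment φ u) :=
  (ContinuousLinearMap.adjoint_inner_right (contToL2.comp (wave φ)) c u).symm

theorem moment_eq_integral (φ : C(AddCircle T, ℝ)) (u : L2 T) : moment φ u = ∫ t, φ t • u t := by
  refine ext_inner_left ℝ fun c => ?_
  rw [← inner_wave, ← integral_inner (integrable_smul φ u), L2.inner_def]
  refine integral_congr_ae ?_
  filter_upwards [coeFn_contToL2 (wave φ c)] with t ht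
  rw [ht, wave_apply, inner_smul_left, inner_smul_right]
  rfl

theorem moment_wave (φ ψ : C(AddCircle T, ℝ)) (c : Cell) :
    moment φ (contToL2 (wave ψ c)) = (∫ t, φ t * ψ t) • c := by
  rw [moment_eq_integral, ← integral_smul_const]
  refine integral_congr_ae ?_
  filter_upwards [coeFn_contToL2 (wave ψ c)] with t ht
  rw [ht, wave_apply, smul_smul]

theorem isWeakDeriv_iff_moment {u v : L2 T} : IsWeakDeriv u v ↔
    ∀ φ ψ : C(AddCircle T, ℝ), ContDiff ℝ ∞ (fun s : ℝ => φ (s : AddCircle T)) →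
    (∀ s : ℝ, HasDerivAt (fun r : ℝ => φ (r : AddCircle T)) (ψ (s : AddCircle T)) s) →
    moment ψ u = - moment φ v := by
  simp only [IsWeakDeriv, moment_eq_integral]

theorem norm_cas_le (n : ℤ) : ‖(cas n : C(AddCircle T, ℝ))‖ ≤ 2 := by
  refine (ContinuousMap.norm_le _ (by norm_num)).2 fun t => ?_
  have h : ‖fourier n t‖ = 1 := Circle.norm_coe _
  have h1 := Complex.abs_re_le_norm (fourier n t)
  have h2 := Complex.abs_im_le_norm (fourier n t)
  rw [cas_apply, Real.norm_eq_abs]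
  exact (abs_add_le _ _).trans (by linarith)

theorem integral_fourier (k : ℤ) :
    ∫ t : AddCircle T, fourier k t = if k = 0 then (T : ℂ) else 0 := by
  split_ifs with h
  · subst h
    simp [measureReal_def, hT.out.le]
  · exact integral_eq_zero_of_add_right_eq_neg (fourier_add_half_inv_index h hT.out)

theorem integral_cas_mul_cas (m n : ℤ) :
    ∫ t : AddCircle T, cas m t * cas n t = if m = n then T else 0 := by
  have hint : ∀ k : ℤ, Integrable (fun t : AddCircle T => fourier k t) :=
    fun k => (fourier k).continuous.integrable_of_hasCompactSupport
      (HasCompactSupport.of_compactSpace _)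
  have h1 : ∀ t : AddCircle T,
      cas m t * cas n t = (fourier (m - n) t).re + (fourier (m + n) t).im := by
    intro t
    rw [sub_eq_add_neg, fourier_add, fourier_add, fourier_neg]
    simp only [cas_apply, Complex.mul_re, Complex.mul_im, Complex.conj_re, Complex.conj_im]
    ring
  simp only [h1]
  have h2 : ∫ t : AddCircle T, (fourier (m - n) t).re = (∫ t : AddCircle T, fourier (m - n) t).re :=
    Complex.reCLM.integral_comp_comm (hint _)
  have h3 : ∫ t : AddCircle T, (fourier (m + n) t).im = (∫ t : AddCircle T, fourier (m + n) t).im :=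
    Complex.imCLM.integral_comp_comm (hint _)
  rw [integral_add (f := fun t => (fourier (m - n) t).re) (g := fun t => (fourier (m + n) t).im)
    (Complex.reCLM.integrable_comp (hint _)) (Complex.imCLM.integrable_comp (hint _)), h2, h3,
    integral_fourier, integral_fourier]
  simp only [sub_eq_zero]
  split_ifs <;> simp

/-- The functions `cas` span: an `L²` loop all of whose Hartley coefficients vanish is zero. -/
theorem eq_zero_of_moment_cas {u : L2 T} (h : ∀ n, moment (cas n) u = 0) : u = 0 := by
  have hcoord : ∀ i : Fin 2, ∀ᵐ t, u t i = 0 := by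
    intro i
    -- Each component, read as a complex function, has vanishing Fourier coefficients.
    have hmem : MemLp (fun t => ((u t i : ℝ) : ℂ)) 2 (volume : Measure (AddCircle T)) :=
      ((Lp.memLp u).continuousLinearMap_comp
        (Complex.ofRealCLM.comp (EuclideanSpace.proj i : Cell →L[ℝ] ℝ)))
    have hmem' := memLp_haarAddCircle_iff.2 hmem
    have hz : hmem'.toLp = 0 := by
      refine fourierBasis.repr.map_eq_zero_iff.1 ?_
      ext n
      rw [fourierBasis_repr, fourierCoeff_congr_ae hmem'.coeFn_toLp]
      rw [fourierCoeff, AddCircle.integral_haarAddCircle]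
      have hi : ∀ k : ℤ, ∫ t, (cas k t * u t i : ℝ) = 0 := by
        intro k
        have := (EuclideanSpace.proj i : Cell →L[ℝ] ℝ).integral_comp_comm
          (integrable_smul (cas k) u)
        rw [← moment_eq_integral, h k, map_zero] at this
        simpa using this
      have hint : ∀ k : ℤ, Integrable (fun t => ((cas k t * u t i : ℝ) : ℂ)) := fun k =>
        ((Complex.ofRealCLM.comp (EuclideanSpace.proj i : Cell →L[ℝ] ℝ)).integrable_comp
          (integrable_smul (cas k) u)).congr (by simp)
      have hf : ∀ t : AddCircle T, fourier (-n) t • ((u t i : ℝ) : ℂ) =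
          ((1 - Complex.I) / 2) * ((cas n t * u t i : ℝ) : ℂ) +
          ((1 + Complex.I) / 2) * ((cas (-n) t * u t i : ℝ) : ℂ) := by
        intro t
        rw [cas_apply, cas_apply, fourier_neg, smul_eq_mul]
        apply Complex.ext <;> simp <;> ring
      simp only [hf]
      rw [integral_add ((hint _).const_mul _) ((hint _).const_mul _), integral_const_mul,
        integral_const_mul, integral_complex_ofReal, integral_complex_ofReal, hi, hi]
      simp
    have h0 : ∀ᵐ t ∂(AddCircle.haarAddCircle : Measure (AddCircle T)), ((u t i : ℝ) : ℂ) = 0 := by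
      have h1 := hmem'.coeFn_toLp
      rw [hz] at h1
      filter_upwards [h1, Lp.coeFn_zero ℂ 2 (AddCircle.haarAddCircle : Measure (AddCircle T))]
        with t h2 h3
      rw [← h2, h3]; rfl
    have h1 : ∀ᵐ t : AddCircle T, ((u t i : ℝ) : ℂ) = 0 :=
      Measure.ae_smul_measure h0 (ENNReal.ofReal T)
    filter_upwards [h1] with t ht
    exact Complex.ofReal_eq_zero.1 ht
  refine (Lp.eq_zero_iff_ae_eq_zero).2 ?_
  filter_upwards [hcoord 0, hcoord 1] with t h0 h1
  ext i
  fin_cases i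
  · exact h0
  · exact h1

theorem integral_hartley_mul_hartley (m n : ℤ) :
    ∫ t : AddCircle T, hartley T m t * hartley T n t = if m = n then 1 else 0 := by
  have h : ∀ t : AddCircle T, hartley T m t * hartley T n t = T⁻¹ * (cas m t * cas n t) := by
    intro t
    have : (√T)⁻¹ * (√T)⁻¹ = T⁻¹ := by rw [← mul_inv, Real.mul_self_sqrt hT.out.le]
    rw [← this]
    simp only [hartley, ContinuousMap.smul_apply, smul_eq_mul]
    ring
  simp only [h]
  rw [integral_const_mul, integral_cas_mul_cas]
  have := hT.out.ne'
  split_ifs <;> simp [this]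

variable (T) in
/-- `c ↦ hartley n • c`, an isometry onto the `n`-th mode. -/
def mode (n : ℤ) : Cell →ₗᵢ[ℝ] L2 T :=
  LinearMap.isometryOfInner
    ((contToL2.comp (wave (hartley T n)) : Cell →L[ℝ] L2 T) : Cell →ₗ[ℝ] L2 T)
    fun c d => by
      change inner ℝ (contToL2 (wave (hartley T n) c)) (contToL2 (wave (hartley T n) d)) = _
      rw [inner_wave, moment_wave, integral_hartley_mul_hartley, if_pos rfl, one_smul]

theorem mode_apply (n : ℤ) (c : Cell) : mode T n c = contToL2 (wave (hartley T n) c) := rfl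

theorem moment_hartley (n : ℤ) (u : L2 T) : moment (hartley T n) u = (√T)⁻¹ • moment (cas n) u := by
  rw [moment_eq_integral, moment_eq_integral, ← integral_smul]
  simp [hartley, smul_smul]

theorem isHilbertSum_mode : IsHilbertSum ℝ (fun _ : ℤ => Cell) (mode T) := by
  refine IsHilbertSum.mk ?_ ?_
  · intro m n hmn c d
    rw [mode_apply, mode_apply, inner_wave, moment_wave, integral_hartley_mul_hartley, if_neg hmn,
      zero_smul, inner_zero_right]
  · rw [top_le_iff, Submodule.topologicalClosure_eq_top_iff, Submodule.eq_bot_iff]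
    intro u hu
    refine eq_zero_of_moment_cas fun n => ?_
    have h0 : moment (hartley T n) u = 0 := by
      refine ext_inner_left ℝ fun c => ?_
      rw [← inner_wave, inner_zero_right]
      exact (Submodule.mem_orthogonal _ _).1 hu _
        (Submodule.mem_iSup_of_mem n ⟨c, rfl⟩)
    rw [moment_hartley, smul_eq_zero] at h0
    exact h0.resolve_left (inv_ne_zero (Real.sqrt_pos.2 hT.out).ne')

variable (T) in
/-- The Hartley transform: the isometry from `L²` loops onto their sequences of coefficients. -/
def hartleyTransform : L2 T ≃ₗᵢ[ℝ] Lattice := isHilbertSum_mode.linearIsometryEquiv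

theorem hartleyTransform_apply (u : L2 T) (n : ℤ) :
    hartleyTransform T u n = moment (hartley T n) u := by
  refine ext_inner_left ℝ fun c => ?_
  have h1 : inner ℝ (lp.single 2 n c : Lattice) (hartleyTransform T u) =
      inner ℝ c (hartleyTransform T u n) := by
    exact lp.inner_single_left (𝕜 := ℝ) (G := fun _ : ℤ => Cell) n c (hartleyTransform T u)
  have h2 : (hartleyTransform T).symm (lp.single 2 n c) = mode T n c :=
    (isHilbertSum_mode (T := T)).linearIsometryEquiv_symm_apply_single c
  rw [← inner_wave, ← mode_apply, ← h1, ← h2]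
  exact ((hartleyTransform T).symm.inner_map_eq_flip _ _).symm

theorem hasSum_mode (u : L2 T) : HasSum (fun n => mode T n (hartleyTransform T u n)) u := by
  have := (isHilbertSum_mode (T := T)).hasSum_linearIsometryEquiv_symm (hartleyTransform T u)
  simpa [hartleyTransform] using this

end

end DimerArray

namespace DimerArray

noncomputable section

open Filter Metric Topology

/-! ### Weak derivatives and parity on the side of the coefficients -/

variable {T : ℝ}

theorem isClosed_setOf_coeff {X : Type*} [TopologicalSpace X] {a b c : X → ℤ → Cell}
    (ha : ∀ n, Continuous fun x => a x n) (hb : ∀ n, Continuous fun x => b x n)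
    (hc : ∀ n, Continuous fun x => c x n) :
    IsClosed {x | (∀ n, b x n = -(freq T n • a x (-n))) ∧
      (∀ n, c x n = -(freq T n • b x (-n))) ∧ ∀ n, a x (-n) = a x n} := by
  have e1 : ∀ n, IsClosed {x | b x n = -(freq T n • a x (-n))} := fun n =>
    isClosed_eq (hb n) ((ha (-n)).const_smul (freq T n)).neg
  have e2 : ∀ n, IsClosed {x | c x n = -(freq T n • b x (-n))} := fun n =>
    isClosed_eq (hc n) ((hb (-n)).const_smul (freq T n)).neg
  have e3 : ∀ n, IsClosed {x | a x (-n) = a x n} := fun n => isClosed_eq (ha (-n)) (ha n)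
  have h := (isClosed_iInter e1).inter ((isClosed_iInter e2).inter (isClosed_iInter e3))
  convert h using 1
  ext x
  simp

variable [hT : Fact (0 < T)]

/-- Integration by parts on the circle. -/
theorem integral_deriv_mul {φ ψ χ ξ : C(AddCircle T, ℝ)}
    (hφ : ∀ s : ℝ, HasDerivAt (fun r : ℝ => φ (r : AddCircle T)) (ψ (s : AddCircle T)) s)
    (hχ : ∀ s : ℝ, HasDerivAt (fun r : ℝ => χ (r : AddCircle T)) (ξ (s : AddCircle T)) s) :
    ∫ t, ψ t * χ t = -∫ t, φ t * ξ t := by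
  have hint : ∀ f : C(AddCircle T, ℝ), Integrable f := fun f =>
    f.continuous.integrable_of_hasCompactSupport (HasCompactSupport.of_compactSpace _)
  have hq : Continuous fun s : ℝ => (s : AddCircle T) := AddCircle.continuous_mk' T
  rw [eq_neg_iff_add_eq_zero]
  have h1 : (∫ t, ψ t * χ t) + ∫ t, φ t * ξ t = ∫ t, (ψ t * χ t + φ t * ξ t) :=
    (integral_add (hint (ψ * χ)) (hint (φ * ξ))).symm
  rw [h1, ← AddCircle.intervalIntegral_preimage T 0 (fun t => ψ t * χ t + φ t * ξ t),
    intervalIntegral.integral_eq_sub_of_hasDerivAt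
      (f := fun s : ℝ => φ (s : AddCircle T) * χ (s : AddCircle T))
      (fun s _ => (hφ s).mul (hχ s))
      (Continuous.intervalIntegrable (by fun_prop) _ _)]
  simp [AddCircle.coe_period]

theorem moment_smul (c : ℝ) (φ : C(AddCircle T, ℝ)) (u : L2 T) :
    moment (c • φ) u = c • moment φ u := by
  rw [moment_eq_integral, moment_eq_integral, ← integral_smul]
  simp [smul_smul]

/-- Since `cas ωₙ t` has derivative `ωₙ cas (-ωₙ t)`, differentiation flips and scales the
coefficients. -/
theorem isWeakDeriv_iff {u v : L2 T} : IsWeakDeriv u v ↔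
    ∀ n, hartleyTransform T v n = -(freq T n • hartleyTransform T u (-n)) := by
  rw [isWeakDeriv_iff_moment]
  constructor
  · intro h n
    have h1 := h (cas n) (freq T n • cas (-n)) (contDiff_cas n) (hasDerivAt_cas n)
    rw [moment_smul] at h1
    rw [hartleyTransform_apply, hartleyTransform_apply, moment_hartley, moment_hartley,
      smul_comm (freq T n), h1, smul_neg, neg_neg]
  · intro h φ ψ _ hψ
    have h1 := (hasSum_mode u).mapL (moment ψ)
    have h2 := (((Equiv.neg ℤ).hasSum_iff).2 ((hasSum_mode v).mapL (moment φ))).neg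
    -- It suffices to integrate by parts in each term of the expansions of `u` and `v`.
    refine h1.unique (h2.congr_fun fun n => ?_)
    have h3 : ∫ t, ψ t * hartley T n t =
        -∫ t, φ t * (freq T n • hartley T (-n) : C(AddCircle T, ℝ)) t := by
      refine integral_deriv_mul hψ fun s => ((hasDerivAt_cas n s).const_smul (√T)⁻¹).congr_deriv ?_
      simp only [hartley, ContinuousMap.smul_apply, smul_eq_mul]
      ring
    have h4 : ∫ t, φ t * (freq T n • hartley T (-n) : C(AddCircle T, ℝ)) t =
        freq T n * ∫ t, φ t * hartley T (-n) t := by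
      rw [← integral_const_mul]
      refine integral_congr_ae (.of_forall fun t => ?_)
      simp only [ContinuousMap.smul_apply, smul_eq_mul]
      ring
    simp only [Function.comp_apply, Equiv.neg_apply, h (-n), neg_neg, freq_neg, neg_smul]
    rw [mode_apply, mode_apply, moment_wave, moment_wave, h3, h4, smul_smul, neg_smul, mul_comm]

theorem isEvenLoop_iff {u : L2 T} : IsEvenLoop u ↔
    ∀ n, hartleyTransform T u (-n) = hartleyTransform T u n := by
  have hflip : ∀ n, hartleyTransform T u (-n) = ∫ t, hartley T n t • u (-t) := by
    intro n
    rw [hartleyTransform_apply, moment_eq_integral, ← integral_neg_eq_self]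
    simp [hartley_neg_apply]
  have hmp := Measure.measurePreserving_neg (volume : Measure (AddCircle T))
  constructor
  · intro h n
    rw [hflip, hartleyTransform_apply, moment_eq_integral]
    refine integral_congr_ae ?_
    filter_upwards [h] with t ht
    rw [ht]
  · intro h
    have hm := (Lp.memLp u).comp_measurePreserving hmp
    have hJ : hm.toLp = u := by
      refine (hartleyTransform T).injective ?_
      ext n : 2
      rw [← h n, hflip, hartleyTransform_apply, moment_eq_integral]
      refine integral_congr_ae ?_
      filter_upwards [hm.coeFn_toLp] with t ht
      rw [ht]; rfl
    have h1 := hm.coeFn_toLp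
    rw [hJ] at h1
    filter_upwards [h1] with t ht
    exact ht.symm

theorem continuous_hartleyTransform_apply (n : ℤ) :
    Continuous fun u : L2 T => hartleyTransform T u n := by
  simp only [hartleyTransform_apply]
  fun_prop

variable (T) in
/-- The closed subspace of even loops in `L²`, the target of the one-site problem. -/
def EvenL2 : Submodule ℝ (L2 T) where
  carrier := {u | ∀ n, hartleyTransform T u (-n) = hartleyTransform T u n}
  zero_mem' n := by simp
  add_mem' h k n := by simp [h n, k n]
  smul_mem' c u h n := by simp [h n]

theorem mem_evenL2 {u : L2 T} : u ∈ EvenL2 T ↔ IsEvenLoop u := isEvenLoop_iff.symm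

instance : CompleteSpace (EvenL2 T) := by
  have : IsClosed (EvenL2 T : Set (L2 T)) := by
    have : (EvenL2 T : Set (L2 T)) =
        ⋂ n, {u | hartleyTransform T u (-n) = hartleyTransform T u n} := by
      ext; simp [EvenL2]
    rw [this]
    exact isClosed_iInter fun n => isClosed_eq (continuous_hartleyTransform_apply _)
      (continuous_hartleyTransform_apply _)
  exact this.completeSpace_coe

/-! ### The Sobolev space -/

theorem mem_H2_iff {u : PiLp 2 (fun _ : Fin 3 => L2 T)} : u ∈ H2 T ↔
    (∀ n, hartleyTransform T (u 1) n = -(freq T n • hartleyTransform T (u 0) (-n))) ∧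
    (∀ n, hartleyTransform T (u 2) n = -(freq T n • hartleyTransform T (u 1) (-n))) ∧
    ∀ n, hartleyTransform T (u 0) (-n) = hartleyTransform T (u 0) n := by
  rw [← isWeakDeriv_iff, ← isWeakDeriv_iff, ← isEvenLoop_iff]
  rfl

instance : CompleteSpace (H2 T) := by
  have hc : ∀ (i : Fin 3) (n : ℤ),
      Continuous fun u : PiLp 2 (fun _ : Fin 3 => L2 T) => hartleyTransform T (u i) n :=
    fun i n => (continuous_hartleyTransform_apply n).comp
      (PiLp.continuous_apply 2 (fun _ : Fin 3 => L2 T) i)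
  have h1 := isClosed_setOf_coeff (T := T) (hc 0) (hc 1) (hc 2)
  have h2 : IsClosed (H2 T : Set (PiLp 2 (fun _ : Fin 3 => L2 T))) := by
    convert h1 using 1
    exact Set.ext fun u => mem_H2_iff
  exact h2.completeSpace_coe

theorem hartleyTransform_ddot (u : H2 T) (n : ℤ) :
    hartleyTransform T (ddot u) n = -(freq T n ^ 2 • hartleyTransform T (toL2 u) n) := by
  obtain ⟨h1, h2, _⟩ := mem_H2_iff.1 u.2
  have h3 := h2 n
  rw [h1 (-n), neg_neg, freq_neg, neg_smul, neg_neg, smul_smul, ← pow_two] at h3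
  exact h3

theorem hartleyTransform_toL2_neg (u : H2 T) (n : ℤ) :
    hartleyTransform T (toL2 u) (-n) = hartleyTransform T (toL2 u) n :=
  (mem_H2_iff.1 u.2).2.2 n

theorem toL2_injective : Function.Injective (toL2 : H2 T → L2 T) := by
  intro u v huv
  obtain ⟨h1, h2, _⟩ := mem_H2_iff.1 u.2
  obtain ⟨k1, k2, _⟩ := mem_H2_iff.1 v.2
  have e0 : (u : PiLp 2 (fun _ : Fin 3 => L2 T)) 0 = (v : PiLp 2 (fun _ : Fin 3 => L2 T)) 0 := huv
  have e1 : (u : PiLp 2 (fun _ : Fin 3 => L2 T)) 1 = (v : PiLp 2 (fun _ : Fin 3 => L2 T)) 1 :=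
    (hartleyTransform T).injective (by ext n : 2; rw [h1, k1, e0])
  have e2 : (u : PiLp 2 (fun _ : Fin 3 => L2 T)) 2 = (v : PiLp 2 (fun _ : Fin 3 => L2 T)) 2 :=
    (hartleyTransform T).injective (by ext n : 2; rw [h2, k2, e1])
  ext i : 2
  fin_cases i
  exacts [e0, e1, e2]

variable (T) in
/-- The inclusion `H² → L²`, with values in the even loops. -/
def toEven : H2 T →L[ℝ] EvenL2 T :=
  ((PiLp.proj 2 (fun _ : Fin 3 => L2 T) 0).comp (H2 T).subtypeL : H2 T →L[ℝ] L2 T).codRestrict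
    (EvenL2 T) hartleyTransform_toL2_neg

variable (T) in
/-- The second derivative `H² → L²`, with values in the even loops. -/
def ddotEven : H2 T →L[ℝ] EvenL2 T :=
  ((PiLp.proj 2 (fun _ : Fin 3 => L2 T) 2).comp (H2 T).subtypeL : H2 T →L[ℝ] L2 T).codRestrict
    (EvenL2 T) fun u n => by
      change hartleyTransform T (ddot u) (-n) = hartleyTransform T (ddot u) n
      rw [hartleyTransform_ddot, hartleyTransform_ddot, freq_neg, neg_sq, hartleyTransform_toL2_neg]

theorem norm_toL2_le (u : H2 T) : ‖toL2 u‖ ≤ ‖u‖ :=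
  PiLp.norm_apply_le (u : PiLp 2 (fun _ : Fin 3 => L2 T)) 0

theorem hartleyTransform_ddot_sub (u : H2 T) (n : ℤ) :
    hartleyTransform T (ddot u - toL2 u) n =
      -((1 + freq T n ^ 2) • hartleyTransform T (toL2 u) n) := by
  rw [map_sub, lp.coeFn_sub, Pi.sub_apply, hartleyTransform_ddot]
  module

theorem exists_lattice_of_norm_le {a : ℤ → Cell} (f : Lattice) (h : ∀ n, ‖a n‖ ≤ ‖f n‖) :
    ∃ X : Lattice, ∀ n, X n = a n :=
  ⟨⟨a, memlp_of_norm_le (X := f) (M := 1) (Equiv.refl ℤ) (by simpa using h)⟩, fun _ => rfl⟩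

variable (T) in
/-- `u ↦ ü - u` is an isomorphism from `H²` onto the even loops in `L²`. -/
theorem bijective_ddot_sub : Function.Bijective (ddotEven T - toEven T) := by
  constructor
  · rw [injective_iff_map_eq_zero]
    intro u hu
    have h0 : ddot u - toL2 u = 0 := congrArg Subtype.val hu
    refine toL2_injective ((hartleyTransform T).injective ?_)
    ext n : 2
    have h1 := hartleyTransform_ddot_sub u n
    rw [h0, map_zero] at h1
    have h2 : (1 + freq T n ^ 2) ≠ 0 := by positivity
    have h3 := (smul_eq_zero.1 (neg_eq_zero.1 h1.symm)).resolve_left h2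
    rw [h3]
    change (0 : Cell) = hartleyTransform T (0 : L2 T) n
    simp
  · intro f
    -- The coefficients of the solution and of its two derivatives; those of `f` are even in `n`.
    set F := hartleyTransform T (f : L2 T) with hF
    have hFe : ∀ n, F (-n) = F n := f.2
    have hpos : ∀ n, 0 < 1 + freq T n ^ 2 := fun n => by positivity
    have hbound : ∀ (c : ℝ) (n : ℤ), |c| ≤ 1 + freq T n ^ 2 →
        ‖(c / (1 + freq T n ^ 2)) • F n‖ ≤ ‖F n‖ := by
      intro c n hc
      rw [norm_smul, Real.norm_eq_abs, abs_div, abs_of_pos (hpos n)]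
      exact mul_le_of_le_one_left (norm_nonneg _) ((div_le_one (hpos n)).2 hc)
    obtain ⟨a, ha⟩ := exists_lattice_of_norm_le F (a := fun n => (-1 / (1 + freq T n ^ 2)) • F n)
      fun n => hbound _ n (by rw [abs_neg, abs_one]; nlinarith [sq_nonneg (freq T n)])
    obtain ⟨b, hb⟩ := exists_lattice_of_norm_le F
      (a := fun n => (freq T n / (1 + freq T n ^ 2)) • F n)
      fun n => hbound _ n (by
        rw [abs_le]
        constructor <;> nlinarith [sq_nonneg (freq T n - 1), sq_nonneg (freq T n + 1)])
    obtain ⟨c, hc⟩ := exists_lattice_of_norm_le F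
      (a := fun n => (freq T n ^ 2 / (1 + freq T n ^ 2)) • F n)
      fun n => hbound _ n (by rw [abs_of_nonneg (sq_nonneg _)]; linarith)
    let U := (hartleyTransform T).symm
    let w : PiLp 2 (fun _ : Fin 3 => L2 T) := WithLp.toLp 2 ![U a, U b, U c]
    have hw0 : hartleyTransform T (w 0) = a := (hartleyTransform T).apply_symm_apply a
    have hw1 : hartleyTransform T (w 1) = b := (hartleyTransform T).apply_symm_apply b
    have hw2 : hartleyTransform T (w 2) = c := (hartleyTransform T).apply_symm_apply c
    have hw : w ∈ H2 T := by
      rw [mem_H2_iff, hw0, hw1, hw2]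
      refine ⟨fun n => ?_, fun n => ?_, fun n => ?_⟩
      · rw [ha, hb, hFe, freq_neg, neg_sq]; module
      · rw [hb, hc, hFe, freq_neg, neg_sq]; module
      · rw [ha, ha, hFe, freq_neg, neg_sq]
    refine ⟨⟨w, hw⟩, Subtype.ext ((hartleyTransform T).injective ?_)⟩
    ext n : 2
    change hartleyTransform T (ddot ⟨w, hw⟩ - toL2 ⟨w, hw⟩) n = F n
    rw [hartleyTransform_ddot_sub]
    change -((1 + freq T n ^ 2) • hartleyTransform T (w 0) n) = F n
    rw [hw0, ha, smul_smul, mul_div_cancel₀ _ (hpos n).ne']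
    module

/-! ### The embedding into continuous functions -/

theorem summable_inv_one_add_freq_sq : Summable fun n : ℤ => (1 + freq T n ^ 2)⁻¹ := by
  have hω : 0 < (2 * Real.pi / T) ^ 2 := by have := hT.out; positivity
  have h := (Real.summable_one_div_int_pow (p := 2)).2 one_lt_two
  refine (h.mul_left ((2 * Real.pi / T) ^ 2)⁻¹).of_norm_bounded_eventually ?_
  rw [Filter.eventually_cofinite]
  refine (Set.finite_singleton (0 : ℤ)).subset fun n hn => ?_
  by_contra hn0
  refine hn ?_
  have hn1 : (0 : ℝ) < (n : ℝ) ^ 2 := by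
    have : (n : ℝ) ≠ 0 := by exact_mod_cast hn0
    positivity
  rw [Real.norm_of_nonneg (by positivity), one_div, ← mul_inv]
  refine inv_anti₀ (by positivity) ?_
  rw [freq, mul_pow]
  linarith

variable (T) in
/-- `u ↦ hartley n • ûₙ`, the `n`-th term of the expansion of `u ∈ H²`. -/
def modeMap (n : ℤ) : H2 T →L[ℝ] C(AddCircle T, Cell) :=
  (wave (hartley T n)).comp ((moment (hartley T n)).comp ((EvenL2 T).subtypeL.comp (toEven T)))

theorem modeMap_apply (n : ℤ) (u : H2 T) :
    modeMap T n u = wave (hartley T n) (hartleyTransform T (toL2 u) n) := by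
  rw [hartleyTransform_apply]
  rfl

variable (T) in
theorem norm_modeMap_le (n : ℤ) : ‖modeMap T n‖ ≤
    (√T)⁻¹ * 2 * ‖ddotEven T - toEven T‖ * (1 + freq T n ^ 2)⁻¹ := by
  refine ContinuousLinearMap.opNorm_le_bound _ (by positivity) fun u => ?_
  have hpos : 0 < 1 + freq T n ^ 2 := by positivity
  have h1 : ‖hartleyTransform T (toL2 u) n‖ ≤
      (1 + freq T n ^ 2)⁻¹ * (‖ddotEven T - toEven T‖ * ‖u‖) := by
    have h2 := hartleyTransform_ddot_sub u n
    have h3 : ‖hartleyTransform T (ddot u - toL2 u) n‖ ≤ ‖ddotEven T - toEven T‖ * ‖u‖ := by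
      refine (lp.norm_apply_le_norm two_ne_zero _ n).trans ?_
      rw [LinearIsometryEquiv.norm_map]
      exact (ddotEven T - toEven T).le_opNorm u
    rw [h2, norm_neg, norm_smul, Real.norm_of_nonneg hpos.le] at h3
    rw [inv_mul_eq_div, le_div_iff₀ hpos]
    linarith
  have h4 : ‖hartley T n‖ ≤ (√T)⁻¹ * 2 := by
    rw [hartley, norm_smul, Real.norm_of_nonneg (by positivity)]
    gcongr
    exact norm_cas_le n
  rw [modeMap_apply]
  calc ‖wave (hartley T n) (hartleyTransform T (toL2 u) n)‖
      ≤ ((√T)⁻¹ * 2) * ((1 + freq T n ^ 2)⁻¹ * (‖ddotEven T - toEven T‖ * ‖u‖)) := by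
        refine ((wave (hartley T n)).le_opNorm _).trans ?_
        gcongr
        exact (norm_wave_le _).trans h4
    _ = _ := by ring

/-- A norm-convergent series of compact operators has a compact sum. -/
theorem exists_compact_hasSum {E F : Type*} [NormedAddCommGroup E] [NormedSpace ℝ E]
    [NormedAddCommGroup F] [NormedSpace ℝ F] [CompleteSpace F] {A : ℤ → E →L[ℝ] F} {g : ℤ → ℝ}
    (hg : Summable g) (hA : ∀ n, ‖A n‖ ≤ g n) (hc : ∀ n, IsCompactOperator (A n)) :
    ∃ S : E →L[ℝ] F, (∀ x, HasSum (fun n => A n x) (S x)) ∧ IsCompactOperator S := by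
  have hs : HasSum A (∑' n, A n) := (Summable.of_norm_bounded hg hA).hasSum
  refine ⟨∑' n, A n, fun x => hs.mapL (ContinuousLinearMap.apply ℝ F x),
    isCompactOperator_of_tendsto hs (Eventually.of_forall fun s => ?_)⟩
  exact (compactOperator (RingHom.id ℝ) E F).sum_mem fun n _ => hc n

theorem isCompactOperator_modeMap (n : ℤ) : IsCompactOperator (modeMap T n) :=
  (isCompactOperator_of_locallyCompactSpace_dom
    ((moment (hartley T n)).comp ((EvenL2 T).subtypeL.comp (toEven T)))).clm_comp
      (wave (hartley T n))

variable (T) in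
/-- The expansion of an element of `H²` converges uniformly, at a rate that makes the embedding
into the continuous functions compact. -/
theorem exists_sobolev : ∃ S : H2 T →L[ℝ] C(AddCircle T, Cell),
    (∀ u, HasSum (fun n => modeMap T n u) (S u)) ∧ IsCompactOperator S :=
  exists_compact_hasSum
    (summable_inv_one_add_freq_sq.mul_left ((√T)⁻¹ * 2 * ‖ddotEven T - toEven T‖))
    (norm_modeMap_le T) isCompactOperator_modeMap

variable (T) in
/-- The Sobolev embedding of `H²` into the continuous loops. -/
def sobolev : H2 T →L[ℝ] C(AddCircle T, Cell) := (exists_sobolev T).choose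

theorem contToL2_sobolev (u : H2 T) : contToL2 (sobolev T u) = toL2 u := by
  have h1 := ((exists_sobolev T).choose_spec.1 u).mapL contToL2
  refine h1.unique ((hasSum_mode (toL2 u)).congr_fun fun n => ?_)
  rw [mode_apply, ← modeMap_apply]

theorem isCompactOperator_sobolev : IsCompactOperator (sobolev T) :=
  (exists_sobolev T).choose_spec.2

end

end DimerArray

/-! ### Compact perturbations of isomorphisms -/

/-- Fredholm's alternative for a compact perturbation of an isomorphism. -/
theorem exists_equiv_of_isCompactOperator {E F : Type*} [NormedAddCommGroup E] [NormedSpace ℝ E]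
    [NormedAddCommGroup F] [NormedSpace ℝ F] [CompleteSpace E] [CompleteSpace F] (A : E ≃L[ℝ] F)
    (B : E →L[ℝ] F) (hB : IsCompactOperator B) (hinj : ∀ x, A x + B x = 0 → x = 0) :
    ∃ L : E ≃L[ℝ] F, (L : E →L[ℝ] F) = (A : E →L[ℝ] F) + B := by
  have hK : IsCompactOperator (B.comp (A.symm : F →L[ℝ] E)) := hB.comp_clm _
  have hres : (-1 : ℝ) ∈ resolventSet ℝ (B.comp (A.symm : F →L[ℝ] E)) := by
    refine (hK.hasEigenvalue_or_mem_resolventSet (by norm_num)).resolve_left fun h => ?_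
    obtain ⟨y, hy⟩ := h.exists_hasEigenvector
    refine hy.2 ?_
    have h1 : B (A.symm y) = (-1 : ℝ) • y := hy.apply_eq_smul
    have h2 := hinj (A.symm y) (by rw [h1]; simp)
    simpa using h2
  rw [spectrum.mem_resolventSet_iff, ContinuousLinearMap.isUnit_iff_bijective] at hres
  have hcomp : ∀ x, ((A : E →L[ℝ] F) + B) x =
      -(algebraMap ℝ (F →L[ℝ] F) (-1) - B.comp (A.symm : F →L[ℝ] E)) (A x) := by
    intro x
    simp [Algebra.algebraMap_eq_smul_one, add_comm]
  have hbij : Function.Bijective ((A : E →L[ℝ] F) + B) := by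
    have := (Equiv.neg F).bijective.comp (hres.comp A.bijective)
    convert this using 1
    exact funext hcomp
  exact ⟨ContinuousLinearEquiv.ofBijective _ (LinearMap.ker_eq_bot.2 hbij.1)
    (LinearMap.range_eq_top.2 hbij.2), by ext; rfl⟩

namespace DimerArray

noncomputable section

open Filter Metric Topology

/-! ### The force of one dimer -/

/-- The derivative of `cellForce`: the Jacobian matrix
`((V''(x^A), -γ), (-γ, V''(x^B)))`. -/
def cellForceDeriv (V : ℝ → ℝ) (γ : ℝ) (x : Cell) : Cell →L[ℝ] Cell :=
  (deriv (deriv V) (x 0) • (EuclideanSpace.proj 0 : Cell →L[ℝ] ℝ)).smulRight !₂[(1 : ℝ), 0] +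
  (deriv (deriv V) (x 1) • (EuclideanSpace.proj 1 : Cell →L[ℝ] ℝ)).smulRight !₂[(0 : ℝ), 1] +
  ((EuclideanSpace.proj 0 : Cell →L[ℝ] ℝ).smulRight !₂[(0 : ℝ), -γ] +
   (EuclideanSpace.proj 1 : Cell →L[ℝ] ℝ).smulRight !₂[-γ, (0 : ℝ)])

theorem cellForceDeriv_apply (V : ℝ → ℝ) (γ : ℝ) (x y : Cell) :
    cellForceDeriv V γ x y =
      !₂[deriv (deriv V) (x 0) * y 0 - γ * y 1, deriv (deriv V) (x 1) * y 1 - γ * y 0] := by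
  ext i
  fin_cases i <;> simp [cellForceDeriv] <;> ring

theorem uniformC1_cellForce {V : ℝ → ℝ} (hV : ContDiff ℝ 2 V) (γ : ℝ) :
    UniformC1 (cellForce V γ) (cellForceDeriv V γ) := by
  have hV1 : ContDiff ℝ 1 (deriv V) := hV.deriv' (n := 1)
  have hV2 : Continuous (deriv (deriv V)) := hV1.continuous_deriv le_rfl
  have hd : ∀ (i : Fin 2) (x : Cell), HasFDerivAt (fun x : Cell => deriv V (x i))
      (deriv (deriv V) (x i) • (EuclideanSpace.proj i : Cell →L[ℝ] ℝ)) x := fun i x =>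
    ((hV1.differentiable one_ne_zero).differentiableAt.hasDerivAt).comp_hasFDerivAt x
      (EuclideanSpace.proj i : Cell →L[ℝ] ℝ).hasFDerivAt
  refine UniformC1.of_continuous (fun x => ?_) ?_
  · have h := (((hd 0 x).smul_const !₂[(1 : ℝ), 0]).add ((hd 1 x).smul_const !₂[(0 : ℝ), 1])).add
      ((EuclideanSpace.proj 0 : Cell →L[ℝ] ℝ).smulRight !₂[(0 : ℝ), -γ] +
        (EuclideanSpace.proj 1 : Cell →L[ℝ] ℝ).smulRight !₂[-γ, (0 : ℝ)]).hasFDerivAt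
    refine h.congr_of_eventuallyEq (Eventually.of_forall fun y => ?_)
    ext i
    fin_cases i <;> simp [cellForce] <;> ring
  · have hc : ∀ i : Fin 2, Continuous fun x : Cell => deriv (deriv V) (x i) := fun i =>
      hV2.comp (EuclideanSpace.proj i : Cell →L[ℝ] ℝ).continuous
    have hs : ∀ (i : Fin 2) (e : Cell), Continuous fun x : Cell =>
        (deriv (deriv V) (x i) • (EuclideanSpace.proj i : Cell →L[ℝ] ℝ)).smulRight e := by
      intro i e
      have : (fun x : Cell =>
          (deriv (deriv V) (x i) • (EuclideanSpace.proj i : Cell →L[ℝ] ℝ)).smulRight e) =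
          fun x => deriv (deriv V) (x i) • (EuclideanSpace.proj i : Cell →L[ℝ] ℝ).smulRight e := by
        ext x y : 2
        simp [mul_smul]
      rw [this]
      exact (hc i).smul continuous_const
    exact ((hs 0 _).add (hs 1 _)).add continuous_const

theorem cellForce_zero {V : ℝ → ℝ} (hV : Function.Even V) (γ : ℝ) : cellForce V γ 0 = 0 := by
  have h : deriv V 0 = 0 := by
    have h1 := deriv_comp_neg V 0
    rw [show (fun x => V (-x)) = V from funext hV, neg_zero] at h1
    linarith
  ext i
  fin_cases i <;> simp [cellForce, h]

/-! ### The one-site problem -/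

variable {T : ℝ} [hT : Fact (0 < T)]

variable (T) in
/-- The orthogonal projection of `L²` onto the even loops. -/
def evenPart : L2 T →L[ℝ] EvenL2 T := (EvenL2 T).orthogonalProjectionOnto

theorem coe_evenPart {w : L2 T} (hw : IsEvenLoop w) : (evenPart T w : L2 T) = w :=
  congrArg Subtype.val
    ((EvenL2 T).orthogonalProjectionOnto_mem_subspace_eq_self ⟨w, mem_evenL2.2 hw⟩)

theorem isEvenLoop_toL2 (u : H2 T) : IsEvenLoop (toL2 u) := u.2.2.2

theorem sobolev_ae (u : H2 T) : ∀ᵐ t, sobolev T u t = toL2 u t := by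
  have h := coeFn_contToL2 (sobolev T u)
  rw [contToL2_sobolev] at h
  filter_upwards [h] with t ht
  exact ht.symm

theorem toL2_zero_ae : ∀ᵐ t : AddCircle T, toL2 (0 : H2 T) t = 0 :=
  Lp.coeFn_zero Cell 2 (volume : Measure (AddCircle T))

/-- The one-site map `x ↦ ẍ + cellForce x` from `H²` to the even loops in `L²`. The projection
onto the even loops does not change its values, and serves to fix the target space. -/
def siteMap {V : ℝ → ℝ} (hV : ContDiff ℝ 2 V) (γ : ℝ) (x : H2 T) : EvenL2 T :=
  ddotEven T x + ((evenPart T).comp contToL2)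
    (ContinuousMap.comp ⟨cellForce V γ, (uniformC1_cellForce hV γ).continuous⟩ (sobolev T x))

/-- The zeroth-order part of the linearization of `siteMap` at `x`. -/
def siteMapPotential {V : ℝ → ℝ} (hV : ContDiff ℝ 2 V) (γ : ℝ) (x : H2 T) : H2 T →L[ℝ] EvenL2 T :=
  ((evenPart T).comp contToL2).comp ((ContinuousMap.fiberwise (ContinuousMap.comp
    ⟨cellForceDeriv V γ, (uniformC1_cellForce hV γ).continuous_deriv⟩ (sobolev T x))).comp
      (sobolev T))

theorem uniformC1_siteMap {V : ℝ → ℝ} (hV : ContDiff ℝ 2 V) (γ : ℝ) :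
    UniformC1 (siteMap (T := T) hV γ) (fun x => ddotEven T + siteMapPotential hV γ x) :=
  (((uniformC1_cellForce hV γ).continuousMap.comp_clm (sobolev T)).clm_comp
    ((evenPart T).comp contToL2)).clm_add (ddotEven T)

theorem siteMap_ae {V : ℝ → ℝ} (hV : ContDiff ℝ 2 V) (γ : ℝ) (x : H2 T) :
    ∀ᵐ t, (siteMap hV γ x : L2 T) t = ddot x t + cellForce V γ (toL2 x t) := by
  set f : C(AddCircle T, Cell) :=
    ContinuousMap.comp ⟨cellForce V γ, (uniformC1_cellForce hV γ).continuous⟩ (sobolev T x)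
  have hf : ∀ᵐ t, contToL2 f t = cellForce V γ (toL2 x t) := by
    filter_upwards [coeFn_contToL2 f, sobolev_ae x] with t h1 h2
    rw [h1, ← h2]; rfl
  have heven : IsEvenLoop (contToL2 f) := by
    filter_upwards [hf, ae_neg hf, isEvenLoop_toL2 x] with t h1 h2 h3
    rw [h1, h2, h3]
  have hval : (siteMap hV γ x : L2 T) = ddot x + contToL2 f :=
    congrArg (ddot x + ·) (coe_evenPart heven)
  rw [hval]
  filter_upwards [Lp.coeFn_add (ddot x) (contToL2 f), hf] with t h1 h2
  rw [h1, Pi.add_apply, h2]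

theorem siteMapPotential_ae {V : ℝ → ℝ} (hV : ContDiff ℝ 2 V) (γ : ℝ) (x y : H2 T) :
    ∀ᵐ t, (siteMapPotential hV γ x y : L2 T) t = cellForceDeriv V γ (toL2 x t) (toL2 y t) := by
  set f : C(AddCircle T, Cell) := ContinuousMap.fiberwise (ContinuousMap.comp
    ⟨cellForceDeriv V γ, (uniformC1_cellForce hV γ).continuous_deriv⟩ (sobolev T x)) (sobolev T y)
  have hf : ∀ᵐ t, contToL2 f t = cellForceDeriv V γ (toL2 x t) (toL2 y t) := by
    filter_upwards [coeFn_contToL2 f, sobolev_ae x, sobolev_ae y] with t h1 h2 h3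
    rw [h1, ← h2, ← h3]; rfl
  have heven : IsEvenLoop (contToL2 f) := by
    filter_upwards [hf, ae_neg hf, isEvenLoop_toL2 x, isEvenLoop_toL2 y] with t h1 h2 h3 h4
    rw [h1, h2, h3, h4]
  have hval : (siteMapPotential hV γ x y : L2 T) = contToL2 f := coe_evenPart heven
  rw [hval]
  exact hf

theorem eq_zero_iff_ae {w : L2 T} : w = 0 ↔ ∀ᵐ t, w t = 0 := Lp.eq_zero_iff_ae_eq_zero

theorem linearization_ae_eq_zero {V : ℝ → ℝ} (hV : ContDiff ℝ 2 V) (γ : ℝ) {x y : H2 T}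
    (h : ddotEven T y + siteMapPotential hV γ x y = 0) : ∀ᵐ t, linearization V γ x y t = 0 := by
  have h1 : ddot y + (siteMapPotential hV γ x y : L2 T) = 0 := congrArg Subtype.val h
  filter_upwards [eq_zero_iff_ae.1 h1, siteMapPotential_ae hV γ x y,
    Lp.coeFn_add (ddot y) (siteMapPotential hV γ x y : L2 T)] with t h2 h3 h4
  rw [linearization, ← cellForceDeriv_apply, ← h3, ← Pi.add_apply, ← h4, h2]

/-- A linearization of the one-site map with trivial kernel is an isomorphism, because the embedding
of `H²` into the continuous functions is compact. -/
theorem exists_equiv_linearization {V : ℝ → ℝ} (hV : ContDiff ℝ 2 V) (γ : ℝ) (x : H2 T)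
    (hker : ∀ y, ddotEven T y + siteMapPotential hV γ x y = 0 → y = 0) :
    ∃ L : H2 T ≃L[ℝ] EvenL2 T, (L : H2 T →L[ℝ] EvenL2 T) =
      ddotEven T + siteMapPotential hV γ x := by
  -- The operator is `(∂² - 1) + (1 + potential)`, an isomorphism plus a compact operator.
  let A : H2 T ≃L[ℝ] EvenL2 T := ContinuousLinearEquiv.ofBijective (ddotEven T - toEven T)
    (LinearMap.ker_eq_bot.2 (bijective_ddot_sub T).1)
    (LinearMap.range_eq_top.2 (bijective_ddot_sub T).2)
  have hA : (A : H2 T →L[ℝ] EvenL2 T) = ddotEven T - toEven T := by ext; rfl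
  have hi : IsCompactOperator (toEven T) := by
    have h := isCompactOperator_sobolev.clm_comp ((evenPart T).comp contToL2)
    have he : ⇑(toEven T) = ⇑((evenPart T).comp contToL2) ∘ ⇑(sobolev T) := by
      funext u
      refine Subtype.ext ?_
      change toL2 u = (evenPart T (contToL2 (sobolev T u)) : L2 T)
      rw [contToL2_sobolev, coe_evenPart (isEvenLoop_toL2 u)]
    rw [he]
    exact h
  have hp : IsCompactOperator (siteMapPotential hV γ x) :=
    isCompactOperator_sobolev.clm_comp (((evenPart T).comp contToL2).comp
      (ContinuousMap.fiberwise (ContinuousMap.comp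
        ⟨cellForceDeriv V γ, (uniformC1_cellForce hV γ).continuous_deriv⟩ (sobolev T x))))
  obtain ⟨L, hL⟩ := exists_equiv_of_isCompactOperator A (toEven T + siteMapPotential hV γ x)
    (hi.add hp) (fun y hy => hker y (by
      rw [← hy]
      change _ = (ddotEven T y - toEven T y) + (toEven T y + siteMapPotential hV γ x y)
      abel))
  refine ⟨L, ?_⟩
  rw [hL, hA]
  abel

theorem moment_compLp (φ : C(AddCircle T, ℝ)) (M : Cell →L[ℝ] Cell) (u : L2 T) :
    moment φ (M.compLp u) = M (moment φ u) := by
  rw [moment_eq_integral, moment_eq_integral, ← M.integral_comp_comm (integrable_smul φ u)]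
  refine integral_congr_ae ?_
  filter_upwards [M.coeFn_compLp u] with t ht
  rw [ht, map_smul]

/-- Without resonances, the linearization at the rest state has no kernel: on the `n`-th mode it
acts by the matrix `((V''(0) - ωₙ², -γ), (-γ, V''(0) - ωₙ²))`. -/
theorem linearization_zero_injective {V : ℝ → ℝ} (hV : ContDiff ℝ 2 V) (γ : ℝ)
    (hres : ∀ n : ℤ, freq T n ^ 2 ≠ deriv (deriv V) 0 + γ ∧ freq T n ^ 2 ≠ deriv (deriv V) 0 - γ)
    {y : H2 T} (h : ddotEven T y + siteMapPotential hV γ 0 y = 0) : y = 0 := by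
  have h1 : ddot y + (cellForceDeriv V γ 0).compLp (toL2 y) = 0 := by
    have h2 : ddot y + (siteMapPotential hV γ 0 y : L2 T) = 0 := congrArg Subtype.val h
    rw [← h2]
    congr 1
    refine Lp.ext ?_
    filter_upwards [siteMapPotential_ae hV γ 0 y, toL2_zero_ae (T := T),
      (cellForceDeriv V γ 0).coeFn_compLp (toL2 y)] with t h3 h4 h5
    rw [h3, h4, h5]
  refine toL2_injective ((hartleyTransform T).injective ?_)
  ext n : 2
  have h2 : hartleyTransform T (ddot y) n +
      hartleyTransform T ((cellForceDeriv V γ 0).compLp (toL2 y)) n = 0 := by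
    rw [← Pi.add_apply, ← lp.coeFn_add, ← map_add, h1, map_zero]
    rfl
  rw [hartleyTransform_ddot, hartleyTransform_apply ((cellForceDeriv V γ 0).compLp (toL2 y)),
    moment_compLp, ← hartleyTransform_apply, cellForceDeriv_apply] at h2
  set a : Cell := hartleyTransform T (toL2 y) n
  have e0 := congrArg (fun c : Cell => c 0) h2
  have e1 := congrArg (fun c : Cell => c 1) h2
  simp at e0 e1
  have hs : (deriv (deriv V) 0 - γ - freq T n ^ 2) * (a 0 + a 1) = 0 := by
    linear_combination e0 + e1
  have hd : (deriv (deriv V) 0 + γ - freq T n ^ 2) * (a 0 - a 1) = 0 := by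
    linear_combination e0 - e1
  have hs' := (mul_eq_zero.1 hs).resolve_left (sub_ne_zero.2 (hres n).2.symm)
  have hd' := (mul_eq_zero.1 hd).resolve_left (sub_ne_zero.2 (hres n).1.symm)
  have hz : (hartleyTransform T (toL2 (0 : H2 T)) n : Cell) = 0 := by
    change hartleyTransform T (0 : L2 T) n = 0
    rw [map_zero]; rfl
  rw [hz]
  ext i
  fin_cases i
  · change a 0 = 0
    linarith
  · change a 1 = 0
    linarith

/-! ### The coupling -/

/-- The matrix element `R_{ml}`, acting on loops. -/
def couplingElement (R : Lattice →L[ℝ] Lattice) (m l : ℤ) : H2 T →L[ℝ] EvenL2 T :=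
  (evenPart T).comp (((matrixElement R m l).compLpL 2 volume).comp
    ((EvenL2 T).subtypeL.comp (toEven T)))

theorem coe_couplingElement (R : Lattice →L[ℝ] Lattice) (m l : ℤ) (x : H2 T) :
    (couplingElement R m l x : L2 T) = (matrixElement R m l).compLp (toL2 x) := by
  refine coe_evenPart (w := (matrixElement R m l).compLp (toL2 x)) ?_
  have h := (matrixElement R m l).coeFn_compLp (toL2 x)
  filter_upwards [h, ae_neg h, isEvenLoop_toL2 x] with t h1 h2 h3
  rw [h1, h2, h3]

theorem norm_couplingElement_le (R : Lattice →L[ℝ] Lattice) (m l : ℤ) :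
    ‖couplingElement (T := T) R m l‖ ≤ ‖matrixElement R m l‖ := by
  refine ContinuousLinearMap.opNorm_le_bound _ (norm_nonneg _) fun x => ?_
  change ‖(couplingElement R m l x : L2 T)‖ ≤ _
  rw [coe_couplingElement]
  refine ((matrixElement R m l).norm_compLp_le _).trans ?_
  gcongr
  exact norm_toL2_le x

theorem coupling_eq (R : Lattice →L[ℝ] Lattice) {C ν : ℝ} (hC : 0 ≤ C) (hν0 : 0 ≤ ν) (hν1 : ν < 1)
    (hR : ∀ m l, ‖matrixElement R m l‖ ≤ C * ν ^ (m - l).natAbs) (X : LoopSpace T) (m : ℤ) :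
    coupling R X m = ((∑' l, couplingElement R m l (X l) : EvenL2 T) : L2 T) := by
  have hs : Summable fun l => couplingElement R m l (X l) := by
    refine Summable.of_norm_bounded
      (((summable_pow_natAbs_sub hν0 hν1 m).mul_left C).mul_right ‖X‖) fun l => ?_
    refine ((couplingElement R m l).le_opNorm (X l)).trans ?_
    gcongr
    · exact (norm_couplingElement_le R m l).trans (hR m l)
    · exact lp.norm_apply_le_norm two_ne_zero X l
  rw [coupling]
  refine (tsum_congr fun l => ?_).trans ((EvenL2 T).subtypeL.map_tsum hs).symm
  exact (coe_couplingElement R m l (X l)).symm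

theorem latticeMap_ae_eq_zero_iff {V : ℝ → ℝ} (hV : ContDiff ℝ 2 V) (γ : ℝ)
    (R : Lattice →L[ℝ] Lattice) {C ν : ℝ} (hC : 0 ≤ C) (hν0 : 0 ≤ ν) (hν1 : ν < 1)
    (hR : ∀ m l, ‖matrixElement R m l‖ ≤ C * ν ^ (m - l).natAbs) (X : LoopSpace T) (lam : ℝ)
    (n : ℤ) : (∀ᵐ t, latticeMap V γ R X lam n t = 0) ↔
      siteMap hV γ (X n) + lam • ∑' l, couplingElement R n l (X l) = 0 := by
  have h0 : siteMap hV γ (X n) + lam • ∑' l, couplingElement R n l (X l) = 0 ↔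
      (siteMap hV γ (X n) : L2 T) + lam • coupling R X n = 0 := by
    rw [coupling_eq R hC hν0 hν1 hR]
    exact Subtype.ext_iff
  rw [h0, eq_zero_iff_ae]
  refine eventually_congr ?_
  filter_upwards [siteMap_ae hV γ (X n), Lp.coeFn_smul lam (coupling R X n),
    Lp.coeFn_add (siteMap hV γ (X n) : L2 T) (lam • coupling R X n)] with t h1 h2 h3
  rw [h3, Pi.add_apply, h1, h2, Pi.smul_apply, latticeMap]

end

end DimerArray

open DimerArray
theorem theorem4p1
    (T : ℝ) [Fact (0 < T)]
    (V : ℝ → ℝ) (hV : ContDiff ℝ 2 V) (hV_even : Function.Even V)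
    (γ : ℝ)
    (R : Lattice →L[ℝ] Lattice) (C ν : ℝ) (hC : 0 < C) (hν0 : 0 < |ν|) (hν1 : |ν| < 1)
    (hR : ∀ (m l : ℤ) (x : Cell), ‖matrixElement R m l x‖ ≤ C * |ν| ^ (m - l).natAbs * ‖x‖)
    (xs : H2 T) (hxs : IsDimerOrbit V γ xs)
    (h_nonres : ∀ n : ℤ,
      (n * (2 * Real.pi / T)) ^ 2 ≠ deriv (deriv V) 0 + γ ∧
      (n * (2 * Real.pi / T)) ^ 2 ≠ deriv (deriv V) 0 - γ)
    (h_nondeg : ∀ y : H2 T, (∀ᵐ t, linearization V γ xs y t = 0) → y = 0) :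
    ∃ lam_b : ℝ, 0 < lam_b ∧
      (∃ X : ℝ → LoopSpace T, IsBreatherCurve V γ R xs lam_b X) ∧
      ∃ C₁ C₂ μ : ℝ, 0 < C₁ ∧ 0 < C₂ ∧ 0 < μ ∧ μ < 1 ∧
        ∀ (Λ : ℝ) (X : ℝ → LoopSpace T), Λ ≤ lam_b → IsBreatherCurve V γ R xs Λ X →
          ∀ lam ∈ Set.Ico 0 Λ, ∀ n : ℤ,
            ‖toL2 (X lam n)‖ ≤ C₁ * Real.exp (C₂ * lam) * μ ^ n.natAbs := by
  have hR' : ∀ m l, ‖matrixElement R m l‖ ≤ C * |ν| ^ (m - l).natAbs := fun m l =>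
    ContinuousLinearMap.opNorm_le_bound _ (by positivity) (hR m l)
  have hsolve := latticeMap_ae_eq_zero_iff (T := T) hV γ R hC.le hν0.le hν1 hR'
  have h0 : siteMap hV γ (0 : H2 T) = 0 := by
    refine Subtype.ext (eq_zero_iff_ae.2 ?_)
    filter_upwards [siteMap_ae hV γ (0 : H2 T), toL2_zero_ae (T := T),
      Lp.coeFn_zero Cell 2 (volume : Measure (AddCircle T))] with t h1 h2 h3
    rw [h1, h2, cellForce_zero hV_even, add_zero]
    exact h3
  have hxs0 : siteMap hV γ xs = 0 := by
    refine Subtype.ext (eq_zero_iff_ae.2 ?_)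
    filter_upwards [siteMap_ae hV γ xs, hxs] with t h1 h2
    rw [h1, h2]
  obtain ⟨L₀, hL₀⟩ := exists_equiv_linearization hV γ (0 : H2 T)
    fun y hy => linearization_zero_injective hV γ h_nonres hy
  obtain ⟨Ls, hLs⟩ := exists_equiv_linearization hV γ xs
    fun y hy => h_nondeg y (linearization_ae_eq_zero hV γ hy)
  obtain ⟨lam_b, hlam_b, ⟨X, hXC, hX0, hX⟩, M, μ, hM, hμ0, hμ1, hloc⟩ :=
    (uniformC1_siteMap hV γ).exists_localized_curve h0 hxs0 L₀ Ls hL₀ hLs hC.le hν0.le hν1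
      (R := couplingElement R) fun m l => (norm_couplingElement_le R m l).trans (hR' m l)
  -- The localization is uniform in `lam`, so any positive `C₂` serves, since `exp (C₂ lam) ≥ 1`.
  refine ⟨lam_b, hlam_b, ⟨X, hXC, hX0, fun lam hlam n => (hsolve _ _ _).2 (hX lam hlam n)⟩,
    M, 1, μ, hM, one_pos, hμ0, hμ1, fun Λ Y hΛ hY lam hlam n => ?_⟩
  have h1 := hloc Λ Y hΛ hY.contDiffOn hY.initial
    (fun t ht m => (hsolve _ _ _).1 (hY.solves t ht m)) lam hlam n
  have h2 : 1 ≤ Real.exp (1 * lam) := Real.one_le_exp (by rw [one_mul]; exact hlam.1)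
  calc ‖toL2 (Y lam n)‖ ≤ M * μ ^ n.natAbs := (norm_toL2_le _).trans h1
    _ ≤ M * Real.exp (1 * lam) * μ ^ n.natAbs := by
      gcongr
      exact le_mul_of_one_le_right hM.le h2
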